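/- **Generalized Computation of Standard Answers.** Let $\varphi=\exists x_n\dots\exists x_1\,\psi(x_1,\dots,x_n)$ be a closed Tarski formula over $\mathbb R$, where $\psi$ is an $\wedge$-$\vee$-combination of atomic constraints $f\mathrel{\varrho}0$ with $f\in\mathbb Z[x_1,\dots,x_n]$ and $\varrho\in\{=,\neq,\le,<,\ge,>\}$. *Elimination terms.* An elimination term $e_i$ for $x_i$ has one of the following forms: (a) a root expression $\frac{a+b\sqrt c}{d}$ with $a,b,c,d\in\mathbb Z[x_{i+1},\dots,x_n]$; (b) $\frac{a+b\sqrt c}{d}\pm\varepsilon$ with $a,b,c,d$ as in (a), where $\varepsilon$ is a positive infinitesimal; (c) $\pm\infty$; (d) $\sqrt[g]{x_{i+1}}$ with $g\in\mathbb N\setminus\{0\}$, $i<n$ (the real root, nonnegative if $g$ is even). A substitution guard $\gamma_i$ for $e_i$ is a quantifier-free Tarski formula in $x_{i+1},\dots,x_n$ that implies over $\mathbb R$ that $e_i$ is meaningful: $c\ge0\wedge d\ne0$ in cases (a), (b), and $x_{i+1}\ge0$ in case (d) if $g$ is even. *Virtual substitution.* The virtual substitution $\chi[x_i/\!/e_i]$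 turns a quantifier-free formula $\chi(x_i,\dots,x_n)$ into a quantifier-free formula in $x_{i+1},\dots,x_n$. In cases (a)–(c) it acts on the atomic constraints $f\mathrel{\varrho}0$. In case (a), $f$ becomes $\frac{A+B\sqrt c}{D}$, and the constraint on it is expressed without root and division; e.g. "$=0$" becomes $A^2-B^2c=0\wedge AB\le0$. In case (b), $f<0$ is first replaced by $f<0\vee(f=0\wedge(\pm f'<0\vee(f'=0\wedge(f''<0\vee\cdots))))$ with derivatives in $x_i$, $f=0$ by the vanishing of all these derivatives, and the other relations accordingly; then the root expression is substituted. In case (c), for $f=\sum_{j\le k}a_jx_i^j$, $f<0$ becomes $(\pm1)^ka_k<0\vee(a_k=0\wedge((\pm1)^{k-1}a_{k-1}<0\vee\cdots))$, $f=0$ becomes $\bigwedge_j a_j=0$, and the other relations accordingly. In case (d), it is any quantifier-free Tarski formula in $x_{i+1},\dots,x_n$ that, whenever $\gamma_i$ holds, is equivalent over $\mathbb R$ to $\chi$ with the real number $\sqrt[g]{x_{i+1}}$ plugged in for $x_i$. (Dividing the exponents of $x_i$ by $g$ yields such a formula if they are multiples of $g$.) *Pre-EQRs.* A scheme $$\left[\begin{array}{l|rrr}\mathrm{true}&x_1=e_1&\dots&x_n=e_n\\&\gamma_1&\dots&\gamma_n\end{array}\right]$$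 of elimination terms $e_i$ with guards $\gamma_i$ is a *pre-EQR for $\varphi$* if $\varphi$ holds in $\mathbb R$ and the variable-free formula $$\gamma_n\wedge\bigl(\cdots\wedge(\gamma_1\wedge\psi[x_1/\!/e_1])\cdots\bigr)[x_n/\!/e_n]$$ is true in $\mathbb R$. *Statement.* There is an algorithm (a partial recursive function on Gödel numbers) which, for all $n$ and $\psi$ as above and every pre-EQR for $\varphi$ with terms $e_1,\dots,e_n$ of the forms (a)–(d) and guards $\gamma_1,\dots,\gamma_n$, halts on $\psi$ and this pre-EQR and returns terms $\widetilde e_1,\dots,\widetilde e_n$, each of the form (a) or (d), and guards $\widetilde\gamma_1,\dots,\widetilde\gamma_n$ such that $$\left[\begin{array}{l|rrr}\mathrm{true}&x_1=\widetilde e_1&\dots&x_n=\widetilde e_n\\&\widetilde\gamma_1&\dots&\widetilde\gamma_n\end{array}\right]$$ is a pre-EQR for $\varphi$ as well. -/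

import Mathlib

/-! Quantifier-free Tarski formulas over the reals, virtual substitution, pre-EQRs.
The variable `x_{i+1}` of the mathematical text is `var i` here (indices start at `0`). -/

namespace VirtualSubst

/-- Polynomial expressions with integer coefficients (terms of the Tarski language, with integer
numerals); `p - q` is written `p + (-1) * q`. -/
inductive PolyExpr : Type
  | const (z : ℤ)
  | var (i : ℕ)
  | add (p q : PolyExpr)
  | mul (p q : PolyExpr)

namespace PolyExpr

/-- Value at the real point `v`. -/
def eval (v : ℕ → ℝ) : PolyExpr → ℝ
  | const z => (z : ℝ)
  | var i => v i
  | add p q => eval v p + eval v q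
  | mul p q => eval v p * eval v q

/-- Every variable that occurs has its index in `[lo, hi)`. -/
def VarsIn (lo hi : ℕ) : PolyExpr → Prop
  | const _ => True
  | var i => lo ≤ i ∧ i < hi
  | add p q => VarsIn lo hi p ∧ VarsIn lo hi q
  | mul p q => VarsIn lo hi p ∧ VarsIn lo hi q

def neg (p : PolyExpr) : PolyExpr := mul (const (-1)) p

def sub (p q : PolyExpr) : PolyExpr := add p (neg q)

/-- `x_k`-derivative. -/
def deriv (k : ℕ) : PolyExpr → PolyExpr
  | const _ => const 0
  | var i => if i = k then const 1 else const 0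
  | add p q => add (deriv k p) (deriv k q)
  | mul p q => add (mul (deriv k p) q) (mul p (deriv k q))

/-- Upper bound for the degree in `x_k`. -/
def deg (k : ℕ) : PolyExpr → ℕ
  | const _ => 0
  | var i => if i = k then 1 else 0
  | add p q => max (deg k p) (deg k q)
  | mul p q => deg k p + deg k q

/-- Sum of two coefficient lists. -/
def addCoeffs : List PolyExpr → List PolyExpr → List PolyExpr
  | [], m => m
  | l, [] => l
  | a :: l, b :: m => add a b :: addCoeffs l m

/-- Product of two coefficient lists. -/
def mulCoeffs : List PolyExpr → List PolyExpr → List PolyExpr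
  | [], _ => []
  | a :: l, m => addCoeffs (m.map (mul a)) (const 0 :: mulCoeffs l m)

/-- The coefficients `[a_0, a_1, …]` of `p = ∑ a_j x_k ^ j`, where `x_k` does not occur in the
`a_j`. -/
def coeffs (k : ℕ) : PolyExpr → List PolyExpr
  | const z => [const z]
  | var i => if i = k then [const 0, const 1] else [var i]
  | add p q => addCoeffs (coeffs k p) (coeffs k q)
  | mul p q => mulCoeffs (coeffs k p) (coeffs k q)

end PolyExpr

/-- A root expression `(a + b √c) / d`. -/
structure RootExpr : Type where
  a : PolyExpr
  b : PolyExpr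
  c : PolyExpr
  d : PolyExpr

/-- The relations of atomic constraints `f ρ 0`. -/
inductive Rel : Type
  | eq
  | ne
  | le
  | lt
  | ge
  | gt

/-- `x ρ 0`. -/
def Rel.Holds : Rel → ℝ → Prop
  | eq, x => x = 0
  | ne, x => x ≠ 0
  | le, x => x ≤ 0
  | lt, x => x < 0
  | ge, x => x ≥ 0
  | gt, x => x > 0

/-- Quantifier-free Tarski formulas: `∧`-`∨`-combinations of atomic constraints `f ρ 0`. -/
inductive QF : Type
  | tt
  | ff
  | atom (p : PolyExpr) (ρ : Rel)
  | and (φ χ : QF)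
  | or (φ χ : QF)

namespace QF

/-- Satisfaction over the reals. -/
def Sat (v : ℕ → ℝ) : QF → Prop
  | tt => True
  | ff => False
  | atom p ρ => ρ.Holds (p.eval v)
  | and φ χ => Sat v φ ∧ Sat v χ
  | or φ χ => Sat v φ ∨ Sat v χ

/-- Every variable that occurs has its index in `[lo, hi)`. -/
def VarsIn (lo hi : ℕ) : QF → Prop
  | tt => True
  | ff => True
  | atom p _ => p.VarsIn lo hi
  | and φ χ => VarsIn lo hi φ ∧ VarsIn lo hi χ
  | or φ χ => VarsIn lo hi φ ∧ VarsIn lo hi χ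

/-- Replace every atomic constraint `p ρ 0` by the formula `F p ρ`. -/
def mapAtoms (F : PolyExpr → Rel → QF) : QF → QF
  | tt => tt
  | ff => ff
  | atom p ρ => F p ρ
  | and φ χ => and (mapAtoms F φ) (mapAtoms F χ)
  | or φ χ => or (mapAtoms F φ) (mapAtoms F χ)

end QF

open PolyExpr QF

/-- `(A, B, D)` with `p[x_k / (a + b √c) / d] = (A + B √c) / D`. -/
def substFrac (k : ℕ) (e : RootExpr) : PolyExpr → PolyExpr × PolyExpr × PolyExpr
  | const z => (const z, const 0, const 1)
  | var i => if i = k then (e.a, e.b, e.d) else (var i, const 0, const 1)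
  | add p q =>
      let r := substFrac k e p
      let s := substFrac k e q
      (add (mul r.1 s.2.2) (mul s.1 r.2.2), add (mul r.2.1 s.2.2) (mul s.2.1 r.2.2),
        mul r.2.2 s.2.2)
  | mul p q =>
      let r := substFrac k e p
      let s := substFrac k e q
      (add (mul r.1 s.1) (mul (mul r.2.1 s.2.1) e.c), add (mul r.1 s.2.1) (mul r.2.1 s.1),
        mul r.2.2 s.2.2)

/-- `(A + B √C) / D < 0` without root and division (for `C ≥ 0`, `D ≠ 0`). -/
def rootLt (A B C D : PolyExpr) : QF :=
  let N := sub (mul A A) (mul (mul B B) C)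
  or (and (atom (mul A D) .lt) (atom N .gt))
    (and (atom (mul B D) .le) (or (atom (mul A D) .lt) (atom N .lt)))

/-- `(A + B √C) / D ≤ 0` without root and division (for `C ≥ 0`, `D ≠ 0`). -/
def rootLe (A B C D : PolyExpr) : QF :=
  let N := sub (mul A A) (mul (mul B B) C)
  or (and (atom (mul A D) .le) (atom N .ge)) (and (atom (mul B D) .le) (atom N .le))

/-- `(A + B √C) / D ρ 0` without root and division (for `C ≥ 0`, `D ≠ 0`). -/
def rootAtom (A B C D : PolyExpr) : Rel → QF
  | .eq => and (atom (sub (mul A A) (mul (mul B B) C)) .eq) (atom (mul A B) .le)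
  | .ne => or (atom (sub (mul A A) (mul (mul B B) C)) .ne) (atom (mul A B) .gt)
  | .lt => rootLt A B C D
  | .le => rootLe A B C D
  | .gt => rootLt (neg A) (neg B) C D
  | .ge => rootLe (neg A) (neg B) C D

/-- Virtual substitution `φ[x_k // e]` of a root expression. -/
def substRoot (k : ℕ) (e : RootExpr) (φ : QF) : QF :=
  φ.mapAtoms fun p ρ =>
    rootAtom (substFrac k e p).1 (substFrac k e p).2.1 e.c (substFrac k e p).2.2 ρ

/-- `a < 0 ∨ (a = 0 ∧ (b < 0 ∨ (b = 0 ∧ …)))` for the list `[a, b, …]`. -/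
def lexLt : List PolyExpr → QF
  | [] => ff
  | a :: l => or (atom a .lt) (and (atom a .eq) (lexLt l))

/-- All members of the list are zero. -/
def allZero : List PolyExpr → QF
  | [] => tt
  | a :: l => and (atom a .eq) (allZero l)

/-- Some member of the list is nonzero. -/
def someNonzero : List PolyExpr → QF
  | [] => ff
  | a :: l => or (atom a .ne) (someNonzero l)

/-- `s ρ 0` for a quantity `s` whose sign is that of the first nonzero member of the list. -/
def lexAtom (l : List PolyExpr) : Rel → QF
  | .eq => allZero l
  | .ne => someNonzero l
  | .lt => lexLt l
  | .le => or (lexLt l) (allZero l)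
  | .gt => lexLt (l.map neg)
  | .ge => or (lexLt (l.map neg)) (allZero l)

/-- `+1` for `true`, `-1` for `false`. -/
def signConst (plus : Bool) : PolyExpr := const (if plus then 1 else -1)

/-- `[p, ± p', p'', ± p''', …]` (derivatives in `x_k`, up to order `m`). -/
def derivList (k : ℕ) (plus : Bool) : ℕ → PolyExpr → List PolyExpr
  | 0, p => [p]
  | m + 1, p => p :: derivList k plus m (mul (signConst plus) (p.deriv k))

/-- Virtual substitution `φ[x_k // e ± ε]`: pass to the conditions on the derivatives, then
substitute `e`. -/
def substRootEps (k : ℕ) (e : RootExpr) (plus : Bool) (φ : QF) : QF :=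
  substRoot k e (φ.mapAtoms fun p ρ => lexAtom (derivList k plus (p.deg k) p) ρ)

/-- `[a_0, ± a_1, a_2, ± a_3, …]`. -/
def alternate (plus : Bool) : List PolyExpr → List PolyExpr
  | [] => []
  | a :: l => a :: (alternate plus l).map (mul (signConst plus))

/-- Virtual substitution `φ[x_k // ± ∞]`: conditions on the coefficients, the leading one first. -/
def substInf (k : ℕ) (plus : Bool) (φ : QF) : QF :=
  φ.mapAtoms fun p ρ => lexAtom (alternate plus (p.coeffs k)).reverse ρ

/-- Elimination terms for a variable `x_k`: a root expression, a root expression `± ε`, `± ∞`,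
or the `g`-th root of the next variable `x_{k+1}` (`true` stands for `+`). -/
inductive ElimTerm : Type
  | root (e : RootExpr)
  | rootEps (e : RootExpr) (plus : Bool)
  | inf (plus : Bool)
  | gthRoot (g : ℕ)

/-- `r` is the real `g`-th root of `y` (the nonnegative one if `g` is even). -/
def IsRealRoot (g : ℕ) (y r : ℝ) : Prop := r ^ g = y ∧ (Even g → 0 ≤ r)

/-- `a`, `b`, `c`, `d` only involve variables with index in `[lo, hi)`. -/
def RootExpr.VarsIn (lo hi : ℕ) (e : RootExpr) : Prop :=
  e.a.VarsIn lo hi ∧ e.b.VarsIn lo hi ∧ e.c.VarsIn lo hi ∧ e.d.VarsIn lo hi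

namespace ElimTerm

/-- An admissible term for `x_k` among `n` variables: it only involves later variables. -/
def WellFormed (n k : ℕ) : ElimTerm → Prop
  | root e => e.VarsIn (k + 1) n
  | rootEps e _ => e.VarsIn (k + 1) n
  | inf _ => True
  | gthRoot g => g ≠ 0 ∧ k + 1 < n

/-- The term for `x_k` is meaningful at `v`. -/
def Meaningful (k : ℕ) (v : ℕ → ℝ) : ElimTerm → Prop
  | root e => 0 ≤ e.c.eval v ∧ e.d.eval v ≠ 0
  | rootEps e _ => 0 ≤ e.c.eval v ∧ e.d.eval v ≠ 0
  | inf _ => True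
  | gthRoot g => Even g → 0 ≤ v (k + 1)

/-- A term without nonstandard symbols. -/
def Standard : ElimTerm → Prop
  | root _ => True
  | rootEps _ _ => False
  | inf _ => False
  | gthRoot _ => True

end ElimTerm

/-- `χ` is a result of the virtual substitution `φ[x_k // e]` under the guard `γ`.
For the `g`-th root of `x_{k+1}` this is a quantifier-free formula in the later variables that
under the guard is equivalent to `φ` with the real root plugged in; the division of the exponents
of `x_k` by `g` (`shift`) is such a result wherever it is applicable (`isVS_shift`). -/
def IsVS (n k : ℕ) (γ φ χ : QF) : ElimTerm → Prop
  | .root e => χ = substRoot k e φ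
  | .rootEps e plus => χ = substRootEps k e plus φ
  | .inf plus => χ = substInf k plus φ
  | .gthRoot g => χ.VarsIn (k + 1) n ∧ ∀ (v : ℕ → ℝ) (r : ℝ), γ.Sat v →
      IsRealRoot g (v (k + 1)) r → (χ.Sat v ↔ φ.Sat (Function.update v k r))

/-- Rows `x_k = e_k` with guards `γ_k`, for consecutive `k`. -/
abbrev Scheme : Type := List (ElimTerm × QF)

/-- Starting with the formula `φ` in `x_k, …, x_{n-1}`, successively pass from `φ` to
`γ_k ∧ φ[x_k // e_k]`; the resulting variable-free formula is true over the reals. -/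
def SubstTrue (n : ℕ) : ℕ → QF → Scheme → Prop
  | _, φ, [] => ∀ v : ℕ → ℝ, φ.Sat v
  | k, φ, (e, γ) :: S => ∃ χ : QF, IsVS n k γ φ χ e ∧ SubstTrue n (k + 1) (and γ χ) S

/-- `ℝ ⊨ ∃ x_{n-1} … ∃ x_0, ψ`. -/
def ExistsHolds (n : ℕ) (ψ : QF) : Prop :=
  ∃ x : Fin n → ℝ, ψ.Sat fun i => if h : i < n then x ⟨i, h⟩ else 0

/-- `S` is a pre-EQR (with condition `true`) for the closed formula `∃ x_{n-1} … ∃ x_0, ψ`. -/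
structure IsPreEQR (n : ℕ) (ψ : QF) (S : Scheme) : Prop where
  closed : ψ.VarsIn 0 n
  length_eq : S.length = n
  wellFormed : ∀ (k : ℕ) (e : ElimTerm) (γ : QF), S[k]? = some (e, γ) →
    e.WellFormed n k ∧ γ.VarsIn (k + 1) n
  guards : ∀ (k : ℕ) (e : ElimTerm) (γ : QF), S[k]? = some (e, γ) →
    ∀ v : ℕ → ℝ, γ.Sat v → e.Meaningful k v
  holds : ExistsHolds n ψ
  result : SubstTrue n 0 ψ S

/-! Gödel numbers (all these maps to `ℕ` are injective). -/

def PolyExpr.code : PolyExpr → ℕ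
  | const z => Nat.pair 0 (Encodable.encode z)
  | var i => Nat.pair 1 i
  | add p q => Nat.pair 2 (Nat.pair p.code q.code)
  | mul p q => Nat.pair 3 (Nat.pair p.code q.code)

def Rel.code : Rel → ℕ
  | eq => 0
  | ne => 1
  | le => 2
  | lt => 3
  | ge => 4
  | gt => 5

def QF.code : QF → ℕ
  | tt => Nat.pair 0 0
  | ff => Nat.pair 1 0
  | atom p ρ => Nat.pair 2 (Nat.pair p.code ρ.code)
  | and φ χ => Nat.pair 3 (Nat.pair φ.code χ.code)
  | or φ χ => Nat.pair 4 (Nat.pair φ.code χ.code)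

def RootExpr.code (e : RootExpr) : ℕ :=
  Nat.pair (Nat.pair e.a.code e.b.code) (Nat.pair e.c.code e.d.code)

def ElimTerm.code : ElimTerm → ℕ
  | root e => Nat.pair 0 e.code
  | rootEps e plus => Nat.pair 1 (Nat.pair plus.toNat e.code)
  | inf plus => Nat.pair 2 plus.toNat
  | gthRoot g => Nat.pair 3 g

def Scheme.code (S : Scheme) : ℕ :=
  Encodable.encode (S.map fun row => Nat.pair row.1.code row.2.code)

/-! The degree shift is a virtual substitution. -/

/-- `∑ a_j y ^ ⌊max (j, g) / g⌋` for `[a_j, a_{j+1}, …]`, the constant term `a_0` being kept. -/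
def shiftSum (g k : ℕ) : ℕ → List PolyExpr → PolyExpr
  | _, [] => const 0
  | j, a :: l =>
      add (mul a (if j = 0 then const 1 else
        (mul (var (k + 1)))^[max j g / g] (const 1))) (shiftSum g k (j + 1) l)

/-- Degree shift: divide the exponents of `x_k` by `g` and write `x_{k+1}` for `x_k`. -/
def shift (g k : ℕ) (φ : QF) : QF :=
  φ.mapAtoms fun p ρ => atom (shiftSum g k 0 (p.coeffs k)) ρ

/-- The degree shift by `g` is applicable to `φ`: in each constraint the exponents of `x_k` are
multiples of `g`, or the left hand side is `f x_k ^ m` with `m > 0`, where `m` may be adjusted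
to `g`: always in equations and disequations, for the same parity in ordering inequalities. -/
def ShiftApplicable (g k : ℕ) : QF → Prop
  | tt => True
  | ff => True
  | atom p ρ =>
      (∀ j a, (p.coeffs k)[j]? = some a → ¬ g ∣ j → ∀ v, a.eval v = 0) ∨
      ∃ m, 0 < m ∧ m < g ∧ (∀ j a, (p.coeffs k)[j]? = some a → j ≠ m → ∀ v, a.eval v = 0) ∧
        (ρ = .eq ∨ ρ = .ne ∨ (Even m ↔ Even g))
  | .and φ χ => ShiftApplicable g k φ ∧ ShiftApplicable g k χ
  | .or φ χ => ShiftApplicable g k φ ∧ ShiftApplicable g k χ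

/-- `a_0 + a_1 r + a_2 r ^ 2 + …`. -/
def evalCoeffs (v : ℕ → ℝ) (r : ℝ) : List PolyExpr → ℝ
  | [] => 0
  | a :: l => a.eval v + r * evalCoeffs v r l

theorem evalCoeffs_add (v : ℕ → ℝ) (r : ℝ) (l m : List PolyExpr) :
    evalCoeffs v r (addCoeffs l m) = evalCoeffs v r l + evalCoeffs v r m := by
  induction l generalizing m with
  | nil => simp [addCoeffs, evalCoeffs]
  | cons a l ih =>
    cases m with
    | nil => simp [addCoeffs, evalCoeffs]
    | cons b m => simp only [addCoeffs, evalCoeffs, PolyExpr.eval, ih]; ring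

theorem evalCoeffs_map_mul (v : ℕ → ℝ) (r : ℝ) (a : PolyExpr) (m : List PolyExpr) :
    evalCoeffs v r (m.map (mul a)) = a.eval v * evalCoeffs v r m := by
  induction m with
  | nil => simp [evalCoeffs]
  | cons b m ih => simp only [List.map_cons, evalCoeffs, PolyExpr.eval, ih]; ring

theorem evalCoeffs_mul (v : ℕ → ℝ) (r : ℝ) (l m : List PolyExpr) :
    evalCoeffs v r (mulCoeffs l m) = evalCoeffs v r l * evalCoeffs v r m := by
  induction l with
  | nil => simp [mulCoeffs, evalCoeffs]
  | cons a l ih =>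
    simp only [mulCoeffs, evalCoeffs_add, evalCoeffs_map_mul, evalCoeffs, PolyExpr.eval, ih]
    push_cast; ring

theorem evalCoeffs_coeffs (v : ℕ → ℝ) (r : ℝ) (k : ℕ) (p : PolyExpr) :
    evalCoeffs v r (p.coeffs k) = p.eval (Function.update v k r) := by
  induction p with
  | const z => simp [coeffs, evalCoeffs, PolyExpr.eval]
  | var i =>
    by_cases h : i = k
    · subst h; simp [coeffs, evalCoeffs, PolyExpr.eval]
    · simp [coeffs, evalCoeffs, PolyExpr.eval, h]
  | add p q hp hq => simp [coeffs, evalCoeffs_add, PolyExpr.eval, hp, hq]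
  | mul p q hp hq => simp [coeffs, evalCoeffs_mul, PolyExpr.eval, hp, hq]

theorem varsIn_addCoeffs (lo hi : ℕ) (l m : List PolyExpr)
    (hl : ∀ a ∈ l, a.VarsIn lo hi) (hm : ∀ a ∈ m, a.VarsIn lo hi) :
    ∀ a ∈ addCoeffs l m, a.VarsIn lo hi := by
  induction l generalizing m with
  | nil => simpa [addCoeffs] using hm
  | cons a l ih =>
    cases m with
    | nil => simpa [addCoeffs] using hl
    | cons b m =>
      simp only [List.forall_mem_cons] at hl hm
      simp only [addCoeffs, List.forall_mem_cons]
      exact ⟨⟨hl.1, hm.1⟩, ih m hl.2 hm.2⟩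

theorem varsIn_mulCoeffs (lo hi : ℕ) (l m : List PolyExpr)
    (hl : ∀ a ∈ l, a.VarsIn lo hi) (hm : ∀ a ∈ m, a.VarsIn lo hi) :
    ∀ a ∈ mulCoeffs l m, a.VarsIn lo hi := by
  induction l with
  | nil => simp [mulCoeffs]
  | cons a l ih =>
    simp only [List.forall_mem_cons] at hl
    refine varsIn_addCoeffs lo hi _ _ ?_ ?_
    · intro b hb
      obtain ⟨c, hc, rfl⟩ := List.mem_map.1 hb
      exact ⟨hl.1, hm c hc⟩
    · simp only [List.forall_mem_cons]
      exact ⟨trivial, ih hl.2⟩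

theorem varsIn_coeffs (n k : ℕ) (p : PolyExpr) (hp : p.VarsIn k n) :
    ∀ a ∈ p.coeffs k, a.VarsIn (k + 1) n := by
  induction p with
  | const z => simp [coeffs, PolyExpr.VarsIn]
  | var i =>
    obtain ⟨h1, h2⟩ := hp
    by_cases h : i = k
    · simp [coeffs, PolyExpr.VarsIn, h]
    · simp only [coeffs, h, if_false, List.mem_singleton, forall_eq, PolyExpr.VarsIn]
      omega
  | add p q ih1 ih2 => exact varsIn_addCoeffs _ _ _ _ (ih1 hp.1) (ih2 hp.2)
  | mul p q ih1 ih2 => exact varsIn_mulCoeffs _ _ _ _ (ih1 hp.1) (ih2 hp.2)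

theorem eval_iterate_mul (v : ℕ → ℝ) (i m : ℕ) :
    ((mul (var i))^[m] (const 1)).eval v = v i ^ m := by
  induction m with
  | zero => simp [PolyExpr.eval]
  | succ m ih => rw [Function.iterate_succ_apply', PolyExpr.eval, ih, PolyExpr.eval]; ring

theorem varsIn_iterate_mul (lo hi i m : ℕ) (h : lo ≤ i ∧ i < hi) :
    ((mul (var i))^[m] (const 1)).VarsIn lo hi := by
  induction m with
  | zero => exact trivial
  | succ m ih => rw [Function.iterate_succ_apply']; exact ⟨h, ih⟩

theorem varsIn_shiftSum (g k n j : ℕ) (l : List PolyExpr) (hk : k + 1 < n)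
    (hl : ∀ a ∈ l, a.VarsIn (k + 1) n) : (shiftSum g k j l).VarsIn (k + 1) n := by
  induction l generalizing j with
  | nil => exact trivial
  | cons a l ih =>
    simp only [List.forall_mem_cons] at hl
    refine ⟨⟨hl.1, ?_⟩, ih _ hl.2⟩
    split_ifs
    · exact trivial
    · exact varsIn_iterate_mul _ _ _ _ ⟨le_rfl, hk⟩

/-- The exponent that replaces `j`. -/
def shiftExp (g j : ℕ) : ℕ := if j = 0 then 0 else max j g / g

theorem eval_shiftSum (v : ℕ → ℝ) (g k j : ℕ) (l : List PolyExpr) :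
    (shiftSum g k j l).eval v =
      ∑ i : Fin l.length, (l.get i).eval v * v (k + 1) ^ shiftExp g (j + i) := by
  induction l generalizing j with
  | nil => simp [shiftSum, PolyExpr.eval]
  | cons a l ih =>
    have e : ∀ i : Fin l.length, j + 1 + (i : ℕ) = j + (i.succ : ℕ) := fun i => by
      simp only [Fin.val_succ]; omega
    rw [shiftSum, PolyExpr.eval, ih, PolyExpr.eval]
    simp only [e]
    refine Eq.trans ?_ (Fin.sum_univ_succ (n := l.length)
      (f := fun i => ((a :: l).get i).eval v * v (k + 1) ^ shiftExp g (j + i))).symm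
    congr 1
    by_cases h : j = 0
    · simp [h, shiftExp, PolyExpr.eval]
    · simp [h, shiftExp, eval_iterate_mul]

theorem evalCoeffs_eq_sum (v : ℕ → ℝ) (r : ℝ) (l : List PolyExpr) :
    evalCoeffs v r l = ∑ i : Fin l.length, (l.get i).eval v * r ^ (i : ℕ) := by
  induction l with
  | nil => simp [evalCoeffs]
  | cons a l ih =>
    rw [evalCoeffs, ih, Finset.mul_sum]
    refine Eq.trans ?_ (Fin.sum_univ_succ (n := l.length)
      (f := fun i => ((a :: l).get i).eval v * r ^ (i : ℕ))).symm
    congr 1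
    · simp
    · refine Finset.sum_congr rfl fun i _ => ?_
      simp only [List.get_eq_getElem, List.length_cons, Fin.val_succ, List.getElem_cons_succ]
      ring

theorem holds_shift_single (g m : ℕ) (hm : 0 < m) (hg : m < g) (a y r : ℝ)
    (hr : IsRealRoot g y r) (ρ : Rel) (hρ : ρ = .eq ∨ ρ = .ne ∨ (Even m ↔ Even g)) :
    ρ.Holds (a * y) ↔ ρ.Holds (a * r ^ m) := by
  obtain ⟨rfl, h0⟩ := hr
  rcases eq_or_ne r 0 with rfl | hne
  · rw [zero_pow (by omega), zero_pow (by omega)]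
  have key : (ρ = .eq ∨ ρ = .ne) ∨ 0 < r ^ g * r ^ m := by
    rcases hρ with h | h | h
    · exact .inl (.inl h)
    · exact .inl (.inr h)
    · right
      rw [← pow_add]
      refine Even.pow_pos ?_ hne
      rw [Nat.even_add]; tauto
  have hm0 : r ^ m ≠ 0 := pow_ne_zero _ hne
  have hg0 : r ^ g ≠ 0 := pow_ne_zero _ hne
  rcases key with (rfl | rfl) | key
  · simp [Rel.Holds, hm0, hg0]
  · simp [Rel.Holds, hm0, hg0]
  · rcases pos_and_pos_or_neg_and_neg_of_mul_pos key with ⟨h1, h2⟩ | ⟨h1, h2⟩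
    · cases ρ <;> simp [Rel.Holds, hm0, hg0, mul_pos_iff_of_pos_right, mul_nonneg_iff_of_pos_right,
        mul_neg_iff, mul_nonpos_iff, h1, h2, h1.le, h2.le, h1.not_gt, h2.not_gt, h1.not_ge,
        h2.not_ge]
    · cases ρ <;> simp [Rel.Holds, hm0, hg0, mul_pos_iff, mul_nonneg_iff,
        mul_neg_iff, mul_nonpos_iff, h1, h2, h1.le, h2.le, h1.not_gt, h2.not_gt, h1.not_ge,
        h2.not_ge]

/-- Where it is applicable, the degree shift is a result of the virtual substitution of the
`g`-th root. -/
theorem isVS_shift (n k g : ℕ) (hg : g ≠ 0) (hk : k + 1 < n) (γ φ : QF) (hφ : φ.VarsIn k n)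
    (h : ShiftApplicable g k φ) : IsVS n k γ φ (shift g k φ) (.gthRoot g) := by
  refine ⟨?_, ?_⟩
  · clear h
    induction φ with
    | tt => exact trivial
    | ff => exact trivial
    | atom p ρ => exact varsIn_shiftSum _ _ _ _ _ hk (varsIn_coeffs n k p hφ)
    | and φ χ h1 h2 => exact ⟨h1 hφ.1, h2 hφ.2⟩
    | or φ χ h1 h2 => exact ⟨h1 hφ.1, h2 hφ.2⟩
  · intro v r _ hr
    induction φ with
    | tt => exact Iff.rfl
    | ff => exact Iff.rfl
    | atom p ρ =>
      change ρ.Holds ((shiftSum g k 0 (p.coeffs k)).eval v) ↔ ρ.Holds (p.eval _)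
      rw [← evalCoeffs_coeffs, eval_shiftSum, evalCoeffs_eq_sum]
      rcases h with h | ⟨m, hm, hmg, h, hρ⟩
      · refine iff_of_eq (congrArg _ (Finset.sum_congr rfl fun i _ => ?_))
        by_cases hd : g ∣ (i : ℕ)
        · obtain ⟨q, hq⟩ := hd
          rw [← hr.1, zero_add, hq, ← pow_mul]
          congr 2
          unfold shiftExp
          rcases Nat.eq_zero_or_pos q with rfl | hq0
          · simp
          · rw [if_neg (by positivity), max_eq_left (Nat.le_mul_of_pos_right g hq0),
              Nat.mul_div_cancel_left _ (Nat.pos_of_ne_zero hg)]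
        · rw [h i _ (by simp) hd, zero_mul, zero_mul]
      · by_cases hlt : m < (p.coeffs k).length
        · rw [Finset.sum_eq_single ⟨m, hlt⟩, Finset.sum_eq_single ⟨m, hlt⟩]
          · have e : shiftExp g (0 + m) = 1 := by
              unfold shiftExp
              rw [zero_add, if_neg hm.ne', max_eq_right hmg.le,
                Nat.div_self (Nat.pos_of_ne_zero hg)]
            simp only [e, pow_one]
            exact holds_shift_single g m hm hmg _ _ _ hr ρ hρ
          · intro i _ hi
            rw [h i _ (by simp) (fun e => hi (Fin.ext e)), zero_mul]
          · simp
          · intro i _ hi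
            rw [h i _ (by simp) (fun e => hi (Fin.ext e)), zero_mul]
          · simp
        · rw [Finset.sum_eq_zero, Finset.sum_eq_zero]
          · intro i _
            rw [h i _ (by simp) (by omega), zero_mul]
          · intro i _
            rw [h i _ (by simp) (by omega), zero_mul]
    | and φ χ h1 h2 => exact and_congr (h1 hφ.1 h.1) (h2 hφ.2 h.2)
    | or φ χ h1 h2 => exact or_congr (h1 hφ.1 h.1) (h2 hφ.2 h.2)

end VirtualSubst

/-! Undoing the virtual substitutions from the last variable to the first yields a real point. A
root expression or a `g`-th root has a real value under its guard. A formula that is true for `e ±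
ε` is true for `e + 1 / z`, and one that is true for `± ∞` is true for `z`, with a suitable integer
`z`: a polynomial in one variable has constant sign close enough to the limit, and the formulas
contain no negation, so finitely many atoms suffice. Replacing the nonstandard symbols by these
integers gives standard terms whose values form a point at which `ψ` is true
(`exists_pinned_point`).

The new guards make these terms a pre-EQR. The guard of `x_k` states that its term is meaningful and
that all later variables equal their own terms. The terms determine each other from the last one
down, so the guard fixes all later variables. Hence a formula substituted for a `g`-th root has to
be correct at one point only, and `tt` will do. It follows that the new scheme is a pre-EQR as soon
as `ψ` together with the equations of all variables is satisfiable (`substTrue_pinnedScheme`).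

The integers are found by unbounded search, which needs a decidable, sound and complete notion of
certificate for that satisfiability. The point is algebraic, so its coordinates lie in some `ℚ(θ)`
with `θ > 0`. After scaling by a large `D + 1`, the number `(D + 1) θ` is isolated between integers
`lo` and `lo + 2`, and all polynomials are written as `P - Q` with coefficients in `ℕ`. Positivity
is certified by `Q (lo + 2) < P lo`, as `P` and `Q` are monotone. Vanishing is certified by a
quotient by a polynomial `M` with root `(D + 1) θ`; this identity over `ℕ` is tested by evaluation
at one large argument. Any such certificate proves satisfiability (`exists_sat_of_cert`), and every
true formula at an algebraic point has one once `D` is large (`exists_cert`). All tests are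
primitive recursive on Gödel numbers, so the search is partial recursive and stops on every pre-EQR.
-/

namespace VirtualSubst

/-! ### Recursion on tagged codes -/

/-- Recursion on codes `Nat.pair tag (Nat.pair i j)`: the codes with a tag up to `t` are leaves, the
others are binary nodes. -/
def treeRec {σ : Type} (t : ℕ) (b : ℕ → σ) (s : ℕ → σ → σ → σ) (n : ℕ) : σ :=
  if h : n.unpair.1 ≤ t then b n
  else
    have hlt : n.unpair.2 < n := by
      have h1 := Nat.add_le_pair n.unpair.1 n.unpair.2
      rw [Nat.pair_unpair] at h1
      omega
    have := Nat.unpair_left_le n.unpair.2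
    have := Nat.unpair_right_le n.unpair.2
    s n.unpair.1 (treeRec t b s n.unpair.2.unpair.1) (treeRec t b s n.unpair.2.unpair.2)
  termination_by n
  decreasing_by all_goals omega

theorem treeRec_leaf {σ : Type} (t : ℕ) (b : ℕ → σ) (s : ℕ → σ → σ → σ) (k r : ℕ) (h : k ≤ t) :
    treeRec t b s (Nat.pair k r) = b (Nat.pair k r) := by
  rw [treeRec]; simp [h]

theorem treeRec_node {σ : Type} (t : ℕ) (b : ℕ → σ) (s : ℕ → σ → σ → σ) (k i j : ℕ) (h : t < k) :
    treeRec t b s (Nat.pair k (Nat.pair i j)) = s k (treeRec t b s i) (treeRec t b s j) := by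
  rw [treeRec]; simp [not_le.2 h]

-- Course-of-values recursion: with tag above `t` both subcodes are smaller than the code, so their
-- values are found in the list of earlier values.
open Primrec in
theorem primrec_treeRec {α σ : Type} [Primcodable α] [Primcodable σ] (t : ℕ) {b : α → ℕ → σ}
    {s : α → ℕ → σ → σ → σ} (hb : Primrec₂ b)
    (hs : Primrec fun x : α × ℕ × σ × σ => s x.1 x.2.1 x.2.2.1 x.2.2.2) :
    Primrec₂ fun a n => treeRec t (b a) (s a) n := by
  have hn : Primrec fun x : α × List σ => x.2.length := list_length.comp snd
  have hu : Primrec fun x : α × List σ => x.2.length.unpair := unpair.comp hn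
  have hv : Primrec fun x : α × List σ => x.2.length.unpair.2.unpair :=
    unpair.comp (snd.comp hu)
  refine nat_strong_rec (g := fun a l =>
    if l.length.unpair.1 ≤ t then some (b a l.length)
    else (l[l.length.unpair.2.unpair.1]?).bind fun x =>
      (l[l.length.unpair.2.unpair.2]?).map fun y => s a l.length.unpair.1 x y) _ ?_ ?_
  · refine Primrec.ite (nat_le.comp (fst.comp hu) (.const t))
      (option_some.comp (hb.comp fst hn)) ?_
    refine option_bind (list_getElem?.comp snd (fst.comp hv)) ?_
    refine option_map (list_getElem?.comp (snd.comp fst) ((snd.comp hv).comp fst)) ?_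
    exact hs.comp (pair (fst.comp (fst.comp fst)) (pair ((fst.comp hu).comp (fst.comp fst))
      (pair (snd.comp fst) snd)))
  · intro a n
    rw [treeRec]
    by_cases h : n.unpair.1 ≤ t
    · simp [h]
    · have h1 := Nat.add_le_pair n.unpair.1 n.unpair.2
      rw [Nat.pair_unpair] at h1
      have h2 := Nat.unpair_left_le n.unpair.2
      have h3 := Nat.unpair_right_le n.unpair.2
      have h4 : n.unpair.2.unpair.1 < n := by omega
      have h5 : n.unpair.2.unpair.2 < n := by omega
      simp [h, h4, h5]

/-! ### Fractions `(pos - neg) / den` -/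

section Triple

variable {R : Type*} [CommSemiring R]

/-- Sum of the fractions `(x.1 - x.2.1) / x.2.2` and `(y.1 - y.2.1) / y.2.2`. -/
def tripleAdd (x y : R × R × R) : R × R × R :=
  (x.1 * y.2.2 + y.1 * x.2.2, x.2.1 * y.2.2 + y.2.1 * x.2.2, x.2.2 * y.2.2)

/-- Product of the fractions `(x.1 - x.2.1) / x.2.2` and `(y.1 - y.2.1) / y.2.2`. -/
def tripleMul (x y : R × R × R) : R × R × R :=
  (x.1 * y.1 + x.2.1 * y.2.1, x.1 * y.2.1 + x.2.1 * y.1, x.2.2 * y.2.2)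

/-- Value of a polynomial expression at a point whose coordinates are given as fractions. -/
def evalTriple (u : ℕ → R × R × R) : PolyExpr → R × R × R
  | .const z => ((z.toNat : R), ((-z).toNat : R), 1)
  | .var i => u i
  | .add p q => tripleAdd (evalTriple u p) (evalTriple u q)
  | .mul p q => tripleMul (evalTriple u p) (evalTriple u q)

/-- Only semiring operations are involved. This links evaluation in `ℕ[X]` with the values at
natural numbers, which are computed, and at `θ`, which matter. -/
theorem map_evalTriple {S : Type*} [CommSemiring S] (h : R →+* S) (u : ℕ → R × R × R)
    (p : PolyExpr) :
    evalTriple (fun i => (h (u i).1, h (u i).2.1, h (u i).2.2)) p =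
      (h (evalTriple u p).1, h (evalTriple u p).2.1, h (evalTriple u p).2.2) := by
  induction p with
  | const z => simp [evalTriple]
  | var i => simp [evalTriple]
  | add p q hp hq => simp [evalTriple, tripleAdd, hp, hq]
  | mul p q hp hq => simp [evalTriple, tripleMul, hp, hq]

end Triple

/-- Value of the polynomial with coefficient list `l`. -/
def horner (l : List ℕ) (t : ℕ) : ℕ := l.foldr (fun a h => a + t * h) 0

/-- A polynomial over `ℚ`: numerator (difference of two coefficient lists) and predecessor of the
denominator. -/
abbrev FracPoly : Type := List ℕ × List ℕ × ℕ

/-- The `i`-th coordinate at `t`. -/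
def coordTriple (A : List FracPoly) (t i : ℕ) : ℕ × ℕ × ℕ :=
  (horner (A.getD i ([], [], 0)).1 t, horner (A.getD i ([], [], 0)).2.1 t,
    (A.getD i ([], [], 0)).2.2 + 1)

/-- `evalTriple` on the code of a polynomial expression. -/
def evalCode (A : List FracPoly) (t : ℕ) (n : ℕ) : ℕ × ℕ × ℕ :=
  treeRec 1
    (fun m =>
      if m.unpair.1 = 0 then
        if m.unpair.2 % 2 = 0 then (m.unpair.2 / 2, 0, 1) else (0, m.unpair.2 / 2 + 1, 1)
      else coordTriple A t m.unpair.2)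
    (fun tag x y => if tag = 2 then tripleAdd x y else tripleMul x y) n

theorem encode_natCast (m : ℕ) : Encodable.encode (m : ℤ) = 2 * m := rfl

theorem encode_negSucc (m : ℕ) : Encodable.encode (Int.negSucc m) = 2 * m + 1 := rfl

/-- The encoding of `ℤ` sends `m` to `2 m` and `-(m + 1)` to `2 m + 1`, whence the parity test on
constants. -/
theorem evalCode_code (A : List FracPoly) (t : ℕ) (p : PolyExpr) :
    evalCode A t p.code = evalTriple (coordTriple A t) p := by
  induction p with
  | const z =>
    rw [PolyExpr.code, evalCode, treeRec_leaf _ _ _ _ _ (by norm_num)]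
    cases z with
    | ofNat m => simp [evalTriple, encode_natCast]
    | negSucc m =>
      have h1 : (2 * m + 1) / 2 = m := by omega
      simp [evalTriple, encode_negSucc, Int.neg_negSucc, h1]
  | var i =>
    rw [PolyExpr.code, evalCode, treeRec_leaf _ _ _ _ _ (by norm_num)]
    simp [evalTriple]
  | add p q hp hq =>
    rw [PolyExpr.code, evalCode, treeRec_node _ _ _ _ _ _ (by norm_num)]
    rw [evalCode] at hp hq
    simp [evalTriple, hp, hq]
  | mul p q hp hq =>
    rw [PolyExpr.code, evalCode, treeRec_node _ _ _ _ _ _ (by norm_num)]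
    rw [evalCode] at hp hq
    simp [evalTriple, hp, hq]

/-! ### Primitive recursiveness of the evaluation on codes -/

open Primrec in
theorem primrec_horner : Primrec₂ horner :=
  list_foldr fst (.const 0) (nat_add.comp (fst.comp snd)
    (nat_mul.comp (snd.comp fst) (snd.comp snd))).to₂

open Primrec in
theorem primrec_coordTriple :
    Primrec fun x : (List FracPoly × ℕ) × ℕ => coordTriple x.1.1 x.1.2 x.2 := by
  have h : Primrec fun x : (List FracPoly × ℕ) × ℕ => x.1.1.getD x.2 ([], [], 0) :=
    (list_getD _).comp (fst.comp fst) snd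
  exact pair (primrec_horner.comp (fst.comp h) (snd.comp fst))
    (pair (primrec_horner.comp (fst.comp (snd.comp h)) (snd.comp fst))
      (succ.comp (snd.comp (snd.comp h))))

open Primrec in
theorem primrec_tripleAdd : Primrec₂ (tripleAdd : ℕ × ℕ × ℕ → ℕ × ℕ × ℕ → ℕ × ℕ × ℕ) := by
  have x1 : Primrec fun z : (ℕ × ℕ × ℕ) × ℕ × ℕ × ℕ => z.1.1 := fst.comp fst
  have x2 : Primrec fun z : (ℕ × ℕ × ℕ) × ℕ × ℕ × ℕ => z.1.2.1 := fst.comp (snd.comp fst)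
  have x3 : Primrec fun z : (ℕ × ℕ × ℕ) × ℕ × ℕ × ℕ => z.1.2.2 := snd.comp (snd.comp fst)
  have y1 : Primrec fun z : (ℕ × ℕ × ℕ) × ℕ × ℕ × ℕ => z.2.1 := fst.comp snd
  have y2 : Primrec fun z : (ℕ × ℕ × ℕ) × ℕ × ℕ × ℕ => z.2.2.1 := fst.comp (snd.comp snd)
  have y3 : Primrec fun z : (ℕ × ℕ × ℕ) × ℕ × ℕ × ℕ => z.2.2.2 := snd.comp (snd.comp snd)
  exact pair (nat_add.comp (nat_mul.comp x1 y3) (nat_mul.comp y1 x3))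
    (pair (nat_add.comp (nat_mul.comp x2 y3) (nat_mul.comp y2 x3)) (nat_mul.comp x3 y3))

open Primrec in
theorem primrec_tripleMul : Primrec₂ (tripleMul : ℕ × ℕ × ℕ → ℕ × ℕ × ℕ → ℕ × ℕ × ℕ) := by
  have x1 : Primrec fun z : (ℕ × ℕ × ℕ) × ℕ × ℕ × ℕ => z.1.1 := fst.comp fst
  have x2 : Primrec fun z : (ℕ × ℕ × ℕ) × ℕ × ℕ × ℕ => z.1.2.1 := fst.comp (snd.comp fst)
  have x3 : Primrec fun z : (ℕ × ℕ × ℕ) × ℕ × ℕ × ℕ => z.1.2.2 := snd.comp (snd.comp fst)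
  have y1 : Primrec fun z : (ℕ × ℕ × ℕ) × ℕ × ℕ × ℕ => z.2.1 := fst.comp snd
  have y2 : Primrec fun z : (ℕ × ℕ × ℕ) × ℕ × ℕ × ℕ => z.2.2.1 := fst.comp (snd.comp snd)
  have y3 : Primrec fun z : (ℕ × ℕ × ℕ) × ℕ × ℕ × ℕ => z.2.2.2 := snd.comp (snd.comp snd)
  exact pair (nat_add.comp (nat_mul.comp x1 y1) (nat_mul.comp x2 y2))
    (pair (nat_add.comp (nat_mul.comp x1 y2) (nat_mul.comp x2 y1)) (nat_mul.comp x3 y3))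

open Primrec in
theorem primrec_evalCode :
    Primrec₂ fun (x : List FracPoly × ℕ) (n : ℕ) => evalCode x.1 x.2 n := by
  refine primrec_treeRec 1 (b := fun (x : List FracPoly × ℕ) m =>
      if m.unpair.1 = 0 then
        if m.unpair.2 % 2 = 0 then (m.unpair.2 / 2, 0, 1) else (0, m.unpair.2 / 2 + 1, 1)
      else coordTriple x.1 x.2 m.unpair.2)
    (s := fun _ tag x y => if tag = 2 then tripleAdd x y else tripleMul x y) ?_ ?_
  · have hu : Primrec fun x : (List FracPoly × ℕ) × ℕ => x.2.unpair := unpair.comp snd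
    have hh : Primrec fun x : (List FracPoly × ℕ) × ℕ => x.2.unpair.2 / 2 :=
      nat_div.comp (snd.comp hu) (.const 2)
    refine Primrec.ite (Primrec.eq.comp (fst.comp hu) (.const 0)) ?_ ?_
    · exact Primrec.ite (Primrec.eq.comp (nat_mod.comp (snd.comp hu) (.const 2)) (.const 0))
        (pair hh (.const (0, 1))) (pair (.const 0) (pair (succ.comp hh) (.const 1)))
    · exact primrec_coordTriple.comp (pair fst (snd.comp hu))
  · exact Primrec.ite (Primrec.eq.comp (fst.comp snd) (.const 2))
      (primrec_tripleAdd.comp (fst.comp (snd.comp snd)) (snd.comp (snd.comp snd)))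
      (primrec_tripleMul.comp (fst.comp (snd.comp snd)) (snd.comp (snd.comp snd)))

/-! ### Certified truth of a formula at a real algebraic point -/

/-- A real algebraic point: a polynomial `M` (difference of two coefficient lists) with a sign
change in `(lo, lo + 2)`, the coordinates as rational polynomials in a root of `M`, and the
quotients by `M` of the polynomials that vanish. -/
abbrev Cert : Type := (List ℕ × List ℕ) × ℕ × List FracPoly × List FracPoly

/-- The two sides of the identity `(c + 1) P = M K` at `t`, sorted by sign. -/
def quotSides (C : Cert) (n : ℕ) (K : FracPoly) (t : ℕ) : ℕ × ℕ :=
  ((K.2.2 + 1) * (evalCode C.2.2.1 t n).1 +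
      (horner C.1.1 t * horner K.2.1 t + horner C.1.2 t * horner K.1 t),
    (K.2.2 + 1) * (evalCode C.2.2.1 t n).2.1 +
      (horner C.1.1 t * horner K.1 t + horner C.1.2 t * horner K.2.1 t))

/-- Both sides of the identity agree at an argument which exceeds their coefficients. -/
def IsQuot (C : Cert) (n : ℕ) (K : FracPoly) : Prop :=
  (quotSides C n K ((quotSides C n K 1).1 + (quotSides C n K 1).2 + 1)).1 =
    (quotSides C n K ((quotSides C n K 1).1 + (quotSides C n K 1).2 + 1)).2

/-- The quotients are not attached to particular constraints, so a longer list certifies at least as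
much. -/
def ZeroCert (C : Cert) (n : ℕ) : Prop := ∃ K ∈ C.2.2.2, IsQuot C n K

/-- Positive and negative part of the numerator are monotone on `[0, ∞)`. If the positive part at
the left end exceeds the negative part at the right end, it does so throughout the interval; the
denominator is positive. -/
def PosCert (C : Cert) (n : ℕ) : Prop :=
  (evalCode C.2.2.1 (C.2.1 + 2) n).2.1 < (evalCode C.2.2.1 C.2.1 n).1

def NegCert (C : Cert) (n : ℕ) : Prop :=
  (evalCode C.2.2.1 (C.2.1 + 2) n).1 < (evalCode C.2.2.1 C.2.1 n).2.1

/-- The code `r` of a relation, applied to the polynomial with code `n`. -/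
def RelCert (C : Cert) (n r : ℕ) : Prop :=
  -- The three groups are the relations satisfied by zero (`=`, `≤`, `≥`), by positive numbers (`≠`,
  -- `≥`, `>`) and by negative numbers (`≠`, `≤`, `<`).
  ((r = 0 ∨ r = 2 ∨ r = 4) ∧ ZeroCert C n) ∨ ((r = 1 ∨ r = 4 ∨ r = 5) ∧ PosCert C n) ∨
    ((r = 1 ∨ r = 2 ∨ r = 3) ∧ NegCert C n)

open Classical in
/-- Certified truth of the formula with code `n`. -/
noncomputable def satCode (C : Cert) (n : ℕ) : Bool :=
  treeRec 2
    (fun m => if m.unpair.1 = 0 then true else if m.unpair.1 = 1 then false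
      else decide (RelCert C m.unpair.2.unpair.1 m.unpair.2.unpair.2))
    (fun tag x y => if tag = 3 then x && y else x || y) n

/-- The sign change of `M`. -/
def RootCert (C : Cert) : Prop :=
  horner C.1.1 C.2.1 < horner C.1.2 C.2.1 ∧ horner C.1.2 (C.2.1 + 2) < horner C.1.1 (C.2.1 + 2)

/-! ### Primitive recursiveness of the certificate check -/

open Primrec in
theorem primrec_quotSides :
    Primrec fun x : (Cert × ℕ × FracPoly) × ℕ => quotSides x.1.1 x.1.2.1 x.1.2.2 x.2 := by
  have hC : Primrec fun x : (Cert × ℕ × FracPoly) × ℕ => x.1.1 := fst.comp fst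
  have hn : Primrec fun x : (Cert × ℕ × FracPoly) × ℕ => x.1.2.1 := fst.comp (snd.comp fst)
  have hK : Primrec fun x : (Cert × ℕ × FracPoly) × ℕ => x.1.2.2 := snd.comp (snd.comp fst)
  have hE : Primrec fun x : (Cert × ℕ × FracPoly) × ℕ => evalCode x.1.1.2.2.1 x.2 x.1.2.1 :=
    primrec_evalCode.comp (pair (fst.comp (snd.comp (snd.comp hC))) snd) hn
  have hM1 := primrec_horner.comp (fst.comp (fst.comp hC)) snd
  have hM2 := primrec_horner.comp (snd.comp (fst.comp hC)) snd
  have hK1 := primrec_horner.comp (fst.comp hK) snd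
  have hK2 := primrec_horner.comp (fst.comp (snd.comp hK)) snd
  have hc := succ.comp (snd.comp (snd.comp hK))
  exact pair
    (nat_add.comp (nat_mul.comp hc (fst.comp hE))
      (nat_add.comp (nat_mul.comp hM1 hK2) (nat_mul.comp hM2 hK1)))
    (nat_add.comp (nat_mul.comp hc (fst.comp (snd.comp hE)))
      (nat_add.comp (nat_mul.comp hM1 hK1) (nat_mul.comp hM2 hK2)))

open Primrec in
theorem primrecPred_isQuot :
    PrimrecPred fun x : Cert × ℕ × FracPoly => IsQuot x.1 x.2.1 x.2.2 := by
  have h1 : Primrec fun x : Cert × ℕ × FracPoly => quotSides x.1 x.2.1 x.2.2 1 :=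
    primrec_quotSides.comp (pair .id (.const 1))
  have h2 : Primrec fun x : Cert × ℕ × FracPoly => quotSides x.1 x.2.1 x.2.2
      ((quotSides x.1 x.2.1 x.2.2 1).1 + (quotSides x.1 x.2.1 x.2.2 1).2 + 1) :=
    primrec_quotSides.comp (pair .id (succ.comp (nat_add.comp (fst.comp h1) (snd.comp h1))))
  exact Primrec.eq.comp (fst.comp h2) (snd.comp h2)

open Primrec in
theorem primrecPred_zeroCert : PrimrecPred fun x : Cert × ℕ => ZeroCert x.1 x.2 := by
  have h : PrimrecRel fun (K : FracPoly) (x : Cert × ℕ) => IsQuot x.1 x.2 K :=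
    primrecPred_isQuot.comp (pair (fst.comp snd) (pair (snd.comp snd) fst))
  exact h.exists_mem_list.comp (snd.comp (snd.comp (snd.comp fst))) .id

open Primrec in
theorem primrec_evalCode_lo : Primrec fun x : Cert × ℕ => evalCode x.1.2.2.1 x.1.2.1 x.2 :=
  primrec_evalCode.comp (pair (fst.comp (snd.comp (snd.comp fst))) (fst.comp (snd.comp fst))) snd

open Primrec in
theorem primrec_evalCode_hi :
    Primrec fun x : Cert × ℕ => evalCode x.1.2.2.1 (x.1.2.1 + 2) x.2 :=
  primrec_evalCode.comp (pair (fst.comp (snd.comp (snd.comp fst)))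
    (succ.comp (succ.comp (fst.comp (snd.comp fst))))) snd

open Primrec in
theorem primrecPred_relCert :
    PrimrecPred fun x : Cert × ℕ × ℕ => RelCert x.1 x.2.1 x.2.2 := by
  have hx : Primrec fun x : Cert × ℕ × ℕ => (x.1, x.2.1) := pair fst (fst.comp snd)
  have hr (k : ℕ) : PrimrecPred fun x : Cert × ℕ × ℕ => x.2.2 = k :=
    Primrec.eq.comp (snd.comp snd) (.const k)
  have hp : PrimrecPred fun x : Cert × ℕ × ℕ => PosCert x.1 x.2.1 :=
    nat_lt.comp (fst.comp (snd.comp (primrec_evalCode_hi.comp hx)))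
      (fst.comp (primrec_evalCode_lo.comp hx))
  have hn : PrimrecPred fun x : Cert × ℕ × ℕ => NegCert x.1 x.2.1 :=
    nat_lt.comp (fst.comp (primrec_evalCode_hi.comp hx))
      (fst.comp (snd.comp (primrec_evalCode_lo.comp hx)))
  exact (((hr 0).or ((hr 2).or (hr 4))).and (primrecPred_zeroCert.comp hx)).or
    ((((hr 1).or ((hr 4).or (hr 5))).and hp).or (((hr 1).or ((hr 2).or (hr 3))).and hn))

open Primrec in
theorem primrec_satCode : Primrec₂ satCode := by
  classical
  refine primrec_treeRec 2
    (b := fun C m => if m.unpair.1 = 0 then true else if m.unpair.1 = 1 then false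
      else decide (RelCert C m.unpair.2.unpair.1 m.unpair.2.unpair.2))
    (s := fun _ tag x y => if tag = 3 then x && y else x || y) ?_ ?_
  · have hu : Primrec fun x : Cert × ℕ => x.2.unpair := unpair.comp snd
    have hv : Primrec fun x : Cert × ℕ => x.2.unpair.2.unpair := unpair.comp (snd.comp hu)
    refine Primrec.ite (Primrec.eq.comp (fst.comp hu) (.const 0)) (.const _)
      (Primrec.ite (Primrec.eq.comp (fst.comp hu) (.const 1)) (.const _) ?_)
    exact (primrecPred_relCert.comp (pair fst (pair (fst.comp hv) (snd.comp hv)))).decide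
  · exact Primrec.ite (Primrec.eq.comp (fst.comp snd) (.const 3))
      (Primrec.and.comp (fst.comp (snd.comp snd)) (snd.comp (snd.comp snd)))
      (Primrec.or.comp (fst.comp (snd.comp snd)) (snd.comp (snd.comp snd)))

open Primrec in
theorem primrecPred_rootCert : PrimrecPred RootCert := by
  have h2 : Primrec fun C : Cert => C.2.1 + 2 := succ.comp (succ.comp (fst.comp snd))
  exact (nat_lt.comp (primrec_horner.comp (fst.comp fst) (fst.comp snd))
      (primrec_horner.comp (snd.comp fst) (fst.comp snd))).and
    (nat_lt.comp (primrec_horner.comp (snd.comp fst) h2) (primrec_horner.comp (fst.comp fst) h2))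

end VirtualSubst

/-! ### Virtual substitution as evaluation at real points -/

namespace VirtualSubst

open PolyExpr QF Filter Topology

/-! ### Root expressions -/

/-- Value of `(a + b √c) / d`. -/
noncomputable def RootExpr.val (v : ℕ → ℝ) (e : RootExpr) : ℝ :=
  (e.a.eval v + e.b.eval v * √(e.c.eval v)) / e.d.eval v

theorem eval_neg (v : ℕ → ℝ) (p : PolyExpr) : p.neg.eval v = -p.eval v := by
  simp [PolyExpr.neg, PolyExpr.eval]

theorem eval_sub (v : ℕ → ℝ) (p q : PolyExpr) : (p.sub q).eval v = p.eval v - q.eval v := by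
  simp [PolyExpr.sub, PolyExpr.eval, eval_neg, sub_eq_add_neg]

theorem substFrac_val (v : ℕ → ℝ) (k : ℕ) (e : RootExpr) (hc : 0 ≤ e.c.eval v)
    (hd : e.d.eval v ≠ 0) (p : PolyExpr) :
    (substFrac k e p).2.2.eval v ≠ 0 ∧
      ((substFrac k e p).1.eval v + (substFrac k e p).2.1.eval v * √(e.c.eval v)) /
        (substFrac k e p).2.2.eval v = p.eval (Function.update v k (e.val v)) := by
  have hs := Real.mul_self_sqrt hc
  induction p with
  | const z => simp [substFrac, PolyExpr.eval]
  | var i =>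
    by_cases h : i = k
    · subst h; simp [substFrac, PolyExpr.eval, hd, RootExpr.val]
    · simp [substFrac, PolyExpr.eval, h]
  | add p q hp hq =>
    simp only [substFrac, PolyExpr.eval]
    obtain ⟨hp0, hp⟩ := hp
    obtain ⟨hq0, hq⟩ := hq
    refine ⟨mul_ne_zero hp0 hq0, ?_⟩
    rw [← hp, ← hq]
    field_simp
    ring
  | mul p q hp hq =>
    simp only [substFrac, PolyExpr.eval]
    obtain ⟨hp0, hp⟩ := hp
    obtain ⟨hq0, hq⟩ := hq
    refine ⟨mul_ne_zero hp0 hq0, ?_⟩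
    rw [← hp, ← hq, div_mul_div_comm]
    congr 1
    linear_combination (-(substFrac k e p).2.1.eval v * (substFrac k e q).2.1.eval v) * hs

/-- The quantity `a² - b² c` is the product of `a + b √c` with its conjugate `a - b √c`. Where it
does not settle the sign, that of `a` or `b` does. -/
theorem add_mul_sqrt_nonpos_iff (a b c : ℝ) (hc : 0 ≤ c) :
    a + b * √c ≤ 0 ↔ (a ≤ 0 ∧ a * a - b * b * c ≥ 0) ∨ (b ≤ 0 ∧ a * a - b * b * c ≤ 0) := by
  have hs := Real.mul_self_sqrt hc
  have h0 := Real.sqrt_nonneg c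
  set s := √c
  have e : a * a - b * b * c = (a - b * s) * (a + b * s) := by rw [← hs]; ring
  rw [e]
  constructor
  · intro h
    rcases le_or_gt (a - b * s) 0 with h1 | h1
    · exact .inl ⟨by linarith, mul_nonneg_of_nonpos_of_nonpos h1 h⟩
    · refine .inr ⟨?_, mul_nonpos_of_nonneg_of_nonpos h1.le h⟩
      by_contra! hb
      nlinarith [mul_nonneg hb.le h0]
  · rintro (⟨h1, h2⟩ | ⟨h1, h2⟩) <;> by_contra! h
    · have h3 : 0 ≤ a - b * s := by
        by_contra! h3
        nlinarith [mul_neg_of_neg_of_pos h3 h]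
      linarith
    · have h3 : a - b * s ≤ 0 := by
        by_contra! h3
        nlinarith [mul_pos h3 h]
      nlinarith [mul_nonneg_of_nonpos_of_nonpos h1 (neg_nonpos.2 h0)]

/-- The complement of the non-strict case for `-a` and `-b`. -/
theorem add_mul_sqrt_neg_iff (a b c : ℝ) (hc : 0 ≤ c) :
    a + b * √c < 0 ↔ (a < 0 ∧ a * a - b * b * c > 0) ∨
      (b ≤ 0 ∧ (a < 0 ∨ a * a - b * b * c < 0)) := by
  have h := add_mul_sqrt_nonpos_iff (-a) (-b) c hc
  rw [← not_iff_not, not_lt]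
  have e : (-a + -b * √c ≤ 0) ↔ 0 ≤ a + b * √c := by
    constructor <;> intro h <;> linarith
  rw [← e, h, neg_mul_neg, neg_mul_neg]
  have h1 : 0 ≤ b * b * c := mul_nonneg (mul_self_nonneg b) hc
  simp only [not_or, not_and, not_lt, gt_iff_lt, ge_iff_le, neg_nonpos]
  constructor
  · rintro (⟨h2, h3⟩ | ⟨h2, h3⟩)
    · exact ⟨fun h4 => by linarith, fun h4 => ⟨h2, h3⟩⟩
    · refine ⟨fun _ => h3, fun h4 => ?_⟩
      obtain rfl : b = 0 := le_antisymm h4 h2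
      have : a * a = 0 := le_antisymm (by simpa using h3) (mul_self_nonneg a)
      simp [mul_self_eq_zero.1 this]
  · rintro ⟨h2, h3⟩
    rcases le_or_gt b 0 with hb | hb
    · exact .inl (h3 hb)
    · rcases le_or_gt 0 a with ha | ha
      · rcases le_total 0 (a * a - b * b * c) with h4 | h4
        · exact .inl ⟨ha, h4⟩
        · exact .inr ⟨hb.le, h4⟩
      · exact .inr ⟨hb.le, h2 ha⟩

/-- The norm vanishes iff `a = ± b √c`; the condition on `a * b` excludes the wrong sign unless both
sides are zero. -/
theorem add_mul_sqrt_eq_zero_iff (a b c : ℝ) (hc : 0 ≤ c) :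
    a + b * √c = 0 ↔ a * a - b * b * c = 0 ∧ a * b ≤ 0 := by
  have hs := Real.mul_self_sqrt hc
  have h0 := Real.sqrt_nonneg c
  set s := √c
  constructor
  · intro h
    have ha : a = -(b * s) := by linarith
    refine ⟨by rw [ha, ← hs]; ring, ?_⟩
    rw [ha]
    nlinarith [mul_nonneg (mul_self_nonneg b) h0]
  · rintro ⟨h1, h2⟩
    have e : (a - b * s) * (a + b * s) = 0 := by rw [← h1, ← hs]; ring
    rcases mul_eq_zero.1 e with h | h
    · have ha : a = b * s := by linarith
      have h3 : b * b * s = 0 := by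
        refine le_antisymm ?_ (mul_nonneg (mul_self_nonneg b) h0)
        rw [ha] at h2
        linarith
      have h4 : b * s = 0 := by
        rcases mul_eq_zero.1 h3 with h | h
        · simp [mul_self_eq_zero.1 h]
        · simp [h]
      rw [ha, h4, add_zero]
    · exact h

theorem div_nonpos_iff_mul_nonpos {y d : ℝ} (hd : d ≠ 0) : y / d ≤ 0 ↔ y * d ≤ 0 := by
  have h := mul_self_pos.2 hd
  rw [← mul_le_mul_iff_left₀ h, zero_mul]
  congr! 1
  field_simp

theorem div_neg_iff_mul_neg {y d : ℝ} (hd : d ≠ 0) : y / d < 0 ↔ y * d < 0 := by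
  have h := mul_self_pos.2 hd
  rw [← mul_lt_mul_iff_left₀ h, zero_mul]
  congr! 1
  field_simp

/-- Multiplication by `D²` turns the quotient into `A D + B D √C`; the norm of this is that of `A +
B √C` times `D² > 0`. -/
theorem sat_rootLe (v : ℕ → ℝ) (A B C D : PolyExpr) (hC : 0 ≤ C.eval v) (hD : D.eval v ≠ 0) :
    (rootLe A B C D).Sat v ↔ (A.eval v + B.eval v * √(C.eval v)) / D.eval v ≤ 0 := by
  simp only [rootLe, Sat, Rel.Holds, PolyExpr.eval, eval_sub]
  have h := mul_self_pos.2 hD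
  rw [div_nonpos_iff_mul_nonpos hD, add_mul, mul_right_comm (B.eval v) (√_),
    add_mul_sqrt_nonpos_iff _ _ _ hC]
  have e : A.eval v * D.eval v * (A.eval v * D.eval v) -
      B.eval v * D.eval v * (B.eval v * D.eval v) * C.eval v =
      (D.eval v * D.eval v) * (A.eval v * A.eval v - B.eval v * B.eval v * C.eval v) := by ring
  rw [e, ge_iff_le, ge_iff_le, mul_nonneg_iff_of_pos_left h, ← neg_nonneg (a := _ * (_ - _)),
    ← mul_neg, mul_nonneg_iff_of_pos_left h, neg_nonneg]

theorem sat_rootLt (v : ℕ → ℝ) (A B C D : PolyExpr) (hC : 0 ≤ C.eval v) (hD : D.eval v ≠ 0) :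
    (rootLt A B C D).Sat v ↔ (A.eval v + B.eval v * √(C.eval v)) / D.eval v < 0 := by
  simp only [rootLt, Sat, Rel.Holds, PolyExpr.eval, eval_sub]
  have h := mul_self_pos.2 hD
  rw [div_neg_iff_mul_neg hD, add_mul, mul_right_comm (B.eval v) (√_),
    add_mul_sqrt_neg_iff _ _ _ hC]
  have e : A.eval v * D.eval v * (A.eval v * D.eval v) -
      B.eval v * D.eval v * (B.eval v * D.eval v) * C.eval v =
      (D.eval v * D.eval v) * (A.eval v * A.eval v - B.eval v * B.eval v * C.eval v) := by ring
  rw [e, gt_iff_lt, gt_iff_lt, mul_pos_iff_of_pos_left h, ← neg_pos (a := _ * (_ - _)),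
    ← mul_neg, mul_pos_iff_of_pos_left h, neg_pos]

theorem sat_rootAtom (v : ℕ → ℝ) (A B C D : PolyExpr) (hC : 0 ≤ C.eval v) (hD : D.eval v ≠ 0)
    (ρ : Rel) : (rootAtom A B C D ρ).Sat v ↔
      ρ.Holds ((A.eval v + B.eval v * √(C.eval v)) / D.eval v) := by
  have e : (-A.eval v + -B.eval v * √(C.eval v)) / D.eval v =
      -((A.eval v + B.eval v * √(C.eval v)) / D.eval v) := by ring
  cases ρ with
  | eq =>
    simp only [rootAtom, Sat, Rel.Holds, PolyExpr.eval, eval_sub, div_eq_zero_iff, hD, or_false]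
    exact (add_mul_sqrt_eq_zero_iff _ _ _ hC).symm
  | ne =>
    simp only [rootAtom, Sat, Rel.Holds, PolyExpr.eval, eval_sub, ne_eq, div_eq_zero_iff, hD,
      or_false, add_mul_sqrt_eq_zero_iff _ _ _ hC, not_and_or, not_le, gt_iff_lt]
  | le => exact sat_rootLe v A B C D hC hD
  | lt => exact sat_rootLt v A B C D hC hD
  | ge =>
    rw [rootAtom, sat_rootLe v _ _ C D hC hD, eval_neg, eval_neg, e]
    exact neg_nonpos
  | gt =>
    rw [rootAtom, sat_rootLt v _ _ C D hC hD, eval_neg, eval_neg, e]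
    exact neg_lt_zero

theorem sat_substRoot (v : ℕ → ℝ) (k : ℕ) (e : RootExpr) (hc : 0 ≤ e.c.eval v)
    (hd : e.d.eval v ≠ 0) (φ : QF) :
    (substRoot k e φ).Sat v ↔ φ.Sat (Function.update v k (e.val v)) := by
  induction φ with
  | tt => exact Iff.rfl
  | ff => exact Iff.rfl
  | atom p ρ =>
    obtain ⟨h1, h2⟩ := substFrac_val v k e hc hd p
    refine (sat_rootAtom v _ _ _ _ hc h1 ρ).trans ?_
    rw [h2]; rfl
  | and φ χ h1 h2 => exact and_congr h1 h2
  | or φ χ h1 h2 => exact or_congr h1 h2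

/-! ### Infinitesimals and infinities -/

/-- The first nonzero member of the list (`0` if there is none). -/
noncomputable def firstNonzero : List ℝ → ℝ
  | [] => 0
  | a :: l => if a = 0 then firstNonzero l else a

theorem firstNonzero_map_mul (s : ℝ) (hs : s ≠ 0) (l : List ℝ) :
    firstNonzero (l.map (s * ·)) = s * firstNonzero l := by
  induction l with
  | nil => simp [firstNonzero]
  | cons a l ih => by_cases h : a = 0 <;> simp [firstNonzero, h, hs, ih]

theorem firstNonzero_append_singleton (l : List ℝ) (a : ℝ) :
    firstNonzero (l ++ [a]) = if firstNonzero l = 0 then a else firstNonzero l := by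
  induction l with
  | nil => by_cases h : a = 0 <;> simp [firstNonzero, h]
  | cons b l ih => by_cases h : b = 0 <;> simp [firstNonzero, h, ih]

theorem sat_lexLt (v : ℕ → ℝ) (l : List PolyExpr) :
    (lexLt l).Sat v ↔ firstNonzero (l.map (·.eval v)) < 0 := by
  induction l with
  | nil => simp [lexLt, Sat, firstNonzero]
  | cons a l ih =>
    by_cases h : a.eval v = 0 <;> simp [lexLt, Sat, firstNonzero, Rel.Holds, h, ih]

theorem sat_allZero (v : ℕ → ℝ) (l : List PolyExpr) :
    (allZero l).Sat v ↔ firstNonzero (l.map (·.eval v)) = 0 := by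
  induction l with
  | nil => simp [allZero, Sat, firstNonzero]
  | cons a l ih =>
    by_cases h : a.eval v = 0 <;> simp [allZero, Sat, firstNonzero, Rel.Holds, h, ih]

theorem sat_someNonzero (v : ℕ → ℝ) (l : List PolyExpr) :
    (someNonzero l).Sat v ↔ firstNonzero (l.map (·.eval v)) ≠ 0 := by
  induction l with
  | nil => simp [someNonzero, Sat, firstNonzero]
  | cons a l ih =>
    by_cases h : a.eval v = 0 <;> simp [someNonzero, Sat, firstNonzero, Rel.Holds, h, ih]

theorem sat_lexAtom (v : ℕ → ℝ) (l : List PolyExpr) (ρ : Rel) :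
    (lexAtom l ρ).Sat v ↔ ρ.Holds (firstNonzero (l.map (·.eval v))) := by
  have e : firstNonzero ((l.map PolyExpr.neg).map (·.eval v)) =
      -firstNonzero (l.map (·.eval v)) := by
    have := firstNonzero_map_mul (-1) (by norm_num) (l.map (·.eval v))
    rw [neg_one_mul] at this
    rw [← this, List.map_map, List.map_map]
    congr 2
    funext p
    simp [eval_neg]
  cases ρ with
  | eq => exact sat_allZero v l
  | ne => exact sat_someNonzero v l
  | lt => exact sat_lexLt v l
  | le =>
    simp only [lexAtom, Sat, sat_lexLt, sat_allZero, Rel.Holds]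
    exact le_iff_lt_or_eq.symm
  | gt =>
    rw [lexAtom, sat_lexLt, e]
    exact neg_lt_zero
  | ge =>
    simp only [lexAtom, Sat, sat_lexLt, sat_allZero, Rel.Holds, e]
    rw [neg_lt_zero, ge_iff_le, le_iff_lt_or_eq, eq_comm (a := (0 : ℝ))]

/-- Eventually `f` has the sign of `c`. -/
def EventuallySign (F : Filter ℝ) (f : ℝ → ℝ) (c : ℝ) : Prop :=
  (c = 0 → ∀ᶠ t in F, f t = 0) ∧ (0 < c → ∀ᶠ t in F, 0 < f t) ∧ (c < 0 → ∀ᶠ t in F, f t < 0)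

theorem EventuallySign.holds {F : Filter ℝ} {f : ℝ → ℝ} {c : ℝ} (h : EventuallySign F f c)
    {ρ : Rel} (hρ : ρ.Holds c) : ∀ᶠ t in F, ρ.Holds (f t) := by
  rcases lt_trichotomy c 0 with hc | hc | hc
  · filter_upwards [h.2.2 hc] with t ht
    cases ρ <;> simp only [Rel.Holds] at hρ ⊢ <;> linarith
  · filter_upwards [h.1 hc] with t ht
    rwa [ht, ← hc]
  · filter_upwards [h.2.1 hc] with t ht
    cases ρ <;> simp only [Rel.Holds] at hρ ⊢ <;> linarith

/-- One implication is enough for what follows. It passes through `∧` and `∨` because no negation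
occurs. -/
theorem eventually_sat_mapAtoms {F : Filter ℝ} {w : ℝ → ℕ → ℝ} {v : ℕ → ℝ}
    {G : PolyExpr → List PolyExpr}
    (hG : ∀ p, EventuallySign F (fun t => p.eval (w t))
      (firstNonzero ((G p).map (·.eval v)))) {φ : QF}
    (h : (φ.mapAtoms fun p ρ => lexAtom (G p) ρ).Sat v) : ∀ᶠ t in F, φ.Sat (w t) := by
  induction φ with
  | tt => exact .of_forall fun _ => trivial
  | ff => exact h.elim
  | atom p ρ => exact (hG p).holds ((sat_lexAtom v _ ρ).1 h)
  | and φ χ h1 h2 => exact (h1 h.1).and (h2 h.2)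
  | or φ χ h1 h2 =>
    rcases h with h | h
    · exact (h1 h).mono fun _ => .inl
    · exact (h2 h).mono fun _ => .inr

/-- `+1` for `true`, `-1` for `false`. -/
noncomputable def boolSign (plus : Bool) : ℝ := if plus then 1 else -1

theorem boolSign_ne_zero (plus : Bool) : boolSign plus ≠ 0 := by cases plus <;> simp [boolSign]

theorem eval_signConst (v : ℕ → ℝ) (plus : Bool) : (signConst plus).eval v = boolSign plus := by
  cases plus <;> simp [signConst, boolSign, PolyExpr.eval]

theorem eventually_one_le_add_mul {c : ℝ} (hc : 0 < c) {h : ℝ → ℝ}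
    (hh : ∀ᶠ t in atTop, c ≤ h t) (a : ℝ) : ∀ᶠ t in atTop, 1 ≤ a + t * h t := by
  filter_upwards [hh, eventually_ge_atTop 0, eventually_ge_atTop ((1 - a) / c)] with t h1 h2 h3
  rw [div_le_iff₀ hc] at h3
  nlinarith [mul_le_mul_of_nonneg_left h1 h2]

theorem eventuallySign_evalCoeffs (v : ℕ → ℝ) (plus : Bool) (l : List PolyExpr) :
    EventuallySign atTop (fun t => evalCoeffs v (boolSign plus * t) l)
      (firstNonzero ((alternate plus l).reverse.map (·.eval v))) := by
  set s := boolSign plus with hs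
  -- For the induction the sign alone is too weak: the tail must stay away from zero, so that `t`
  -- times the tail outweighs the constant term.
  have key : (firstNonzero ((alternate plus l).reverse.map (·.eval v)) = 0 →
        ∀ᶠ t : ℝ in atTop, evalCoeffs v (s * t) l = 0) ∧
      (0 < firstNonzero ((alternate plus l).reverse.map (·.eval v)) →
        ∃ c > 0, ∀ᶠ t : ℝ in atTop, c ≤ evalCoeffs v (s * t) l) ∧
      (firstNonzero ((alternate plus l).reverse.map (·.eval v)) < 0 →
        ∃ c > 0, ∀ᶠ t : ℝ in atTop, evalCoeffs v (s * t) l ≤ -c) := by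
    induction l with
    | nil => simp [alternate, firstNonzero, evalCoeffs]
    | cons a l ih =>
      have e : ((alternate plus (a :: l)).reverse.map (·.eval v)) =
          ((alternate plus l).reverse.map (·.eval v)).map (s * ·) ++ [a.eval v] := by
        simp only [alternate, List.reverse_cons, List.map_append, List.map_reverse, List.map_map,
          List.map_cons, List.map_nil]
        congr 3
        funext p
        simp [PolyExpr.eval, eval_signConst, hs]
      rw [e, firstNonzero_append_singleton, firstNonzero_map_mul _ (boolSign_ne_zero plus)]
      set c := firstNonzero ((alternate plus l).reverse.map (·.eval v)) with hc
      have hf (t : ℝ) : evalCoeffs v (s * t) (a :: l) =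
          a.eval v + t * (s * evalCoeffs v (s * t) l) := by rw [evalCoeffs]; ring
      simp only [hf]
      rcases eq_or_ne c 0 with h0 | h0
      · have hev : ∀ᶠ t : ℝ in atTop,
            a.eval v + t * (s * evalCoeffs v (s * t) l) = a.eval v := by
          filter_upwards [ih.1 h0] with t ht
          simp [ht]
        rw [h0, mul_zero, if_pos rfl]
        refine ⟨fun h => ?_, fun h => ⟨_, h, ?_⟩, fun h => ⟨_, neg_pos.2 h, ?_⟩⟩
        · exact hev.mono fun t ht => ht.trans h
        · exact hev.mono fun t ht => ht.ge
        · exact hev.mono fun t ht => by rw [ht, neg_neg]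
      · have hsc : s * c ≠ 0 := mul_ne_zero (boolSign_ne_zero plus) h0
        rw [if_neg hsc]
        have hpos : 0 < s * c → ∃ c' > 0, ∀ᶠ t : ℝ in atTop,
            c' ≤ s * evalCoeffs v (s * t) l := by
          intro h
          rcases plus with _ | _
          · obtain ⟨c', h1, h2⟩ := ih.2.2 (by simpa [hs, boolSign] using h)
            exact ⟨c', h1, h2.mono fun t ht => by simpa [hs, boolSign] using le_neg_of_le_neg ht⟩
          · obtain ⟨c', h1, h2⟩ := ih.2.1 (by simpa [hs, boolSign] using h)
            exact ⟨c', h1, h2.mono fun t ht => by simpa [hs, boolSign] using ht⟩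
        have hneg : s * c < 0 → ∃ c' > 0, ∀ᶠ t : ℝ in atTop,
            c' ≤ -(s * evalCoeffs v (s * t) l) := by
          intro h
          rcases plus with _ | _
          · obtain ⟨c', h1, h2⟩ := ih.2.1 (by simpa [hs, boolSign] using h)
            exact ⟨c', h1, h2.mono fun t ht => by simpa [hs, boolSign] using ht⟩
          · obtain ⟨c', h1, h2⟩ := ih.2.2 (by simpa [hs, boolSign] using h)
            exact ⟨c', h1, h2.mono fun t ht => by simpa [hs, boolSign] using le_neg_of_le_neg ht⟩
        refine ⟨fun h => (hsc h).elim, fun h => ⟨1, one_pos, ?_⟩, fun h => ⟨1, one_pos, ?_⟩⟩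
        · obtain ⟨c', h1, h2⟩ := hpos h
          exact eventually_one_le_add_mul h1 h2 _
        · obtain ⟨c', h1, h2⟩ := hneg h
          filter_upwards [eventually_one_le_add_mul h1 h2 (-a.eval v)] with t ht
          linarith
  refine ⟨key.1, fun h => ?_, fun h => ?_⟩
  · obtain ⟨c, hc, h⟩ := key.2.1 h
    exact h.mono fun t ht => hc.trans_le ht
  · obtain ⟨c, hc, h⟩ := key.2.2 h
    exact h.mono fun t ht => ht.trans_lt (neg_lt_zero.2 hc)

theorem eventually_sat_of_substInf (v : ℕ → ℝ) (k : ℕ) (plus : Bool) {φ : QF}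
    (h : (substInf k plus φ).Sat v) :
    ∀ᶠ t in atTop, φ.Sat (Function.update v k (boolSign plus * t)) := by
  refine eventually_sat_mapAtoms (G := fun p => (alternate plus (p.coeffs k)).reverse) ?_ h
  intro p
  simp only [← evalCoeffs_coeffs]
  exact eventuallySign_evalCoeffs v plus _

/-- The polynomial function `x_k ↦ p`, the other variables having their values in `v`. -/
noncomputable def toPolynomial (v : ℕ → ℝ) (k : ℕ) : PolyExpr → Polynomial ℝ
  | const z => Polynomial.C (z : ℝ)
  | var i => if i = k then Polynomial.X else Polynomial.C (v i)
  | add p q => toPolynomial v k p + toPolynomial v k q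
  | mul p q => toPolynomial v k p * toPolynomial v k q

theorem eval_toPolynomial (v : ℕ → ℝ) (k : ℕ) (r : ℝ) (p : PolyExpr) :
    (toPolynomial v k p).eval r = p.eval (Function.update v k r) := by
  induction p with
  | const z => simp [toPolynomial, PolyExpr.eval]
  | var i =>
    by_cases h : i = k
    · subst h; simp [toPolynomial, PolyExpr.eval]
    · simp [toPolynomial, PolyExpr.eval, h]
  | add p q hp hq => simp [toPolynomial, PolyExpr.eval, hp, hq]
  | mul p q hp hq => simp [toPolynomial, PolyExpr.eval, hp, hq]

theorem natDegree_toPolynomial_le (v : ℕ → ℝ) (k : ℕ) (p : PolyExpr) :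
    (toPolynomial v k p).natDegree ≤ p.deg k := by
  induction p with
  | const z => simp [toPolynomial]
  | var i => by_cases h : i = k <;> simp [toPolynomial, PolyExpr.deg, h]
  | add p q hp hq =>
    exact (Polynomial.natDegree_add_le _ _).trans (max_le_max hp hq)
  | mul p q hp hq => exact Polynomial.natDegree_mul_le.trans (add_le_add hp hq)

theorem toPolynomial_deriv (v : ℕ → ℝ) (k : ℕ) (p : PolyExpr) :
    toPolynomial v k (p.deriv k) = (toPolynomial v k p).derivative := by
  induction p with
  | const z => simp [toPolynomial, PolyExpr.deriv]
  | var i => by_cases h : i = k <;> simp [toPolynomial, PolyExpr.deriv, h]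
  | add p q hp hq => simp [toPolynomial, PolyExpr.deriv, hp, hq]
  | mul p q hp hq => simp [toPolynomial, PolyExpr.deriv, hp, hq]

theorem eventually_pos_of_deriv_pos {f f' : ℝ → ℝ} (hf : ∀ t, HasDerivAt f (f' t) t)
    (h0 : f 0 = 0) (h : ∀ᶠ t in 𝓝[>] (0 : ℝ), 0 < f' t) : ∀ᶠ t in 𝓝[>] (0 : ℝ), 0 < f t := by
  obtain ⟨u, hu, hsub⟩ := mem_nhdsGT_iff_exists_Ioo_subset.1 h
  filter_upwards [Ioo_mem_nhdsGT hu] with t ht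
  have hmono : StrictMonoOn f (Set.Icc 0 t) := by
    refine strictMonoOn_of_deriv_pos (convex_Icc 0 t)
      (fun x _ => (hf x).continuousAt.continuousWithinAt) fun x hx => ?_
    rw [interior_Icc] at hx
    rw [(hf x).deriv]
    exact hsub ⟨hx.1, hx.2.trans ht.2⟩
  rw [← h0]
  exact hmono ⟨le_rfl, ht.1.le⟩ ⟨ht.1.le, le_rfl⟩ ht.1

/-- A nonzero value at the base point decides by continuity. Otherwise the sign is that of the
derivative in `t`, to which the induction applies, since the degree drops. -/
theorem eventuallySign_derivList (v : ℕ → ℝ) (k : ℕ) (plus : Bool) (m : ℕ) (p : PolyExpr)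
    (hp : (toPolynomial v k p).natDegree ≤ m) :
    EventuallySign (𝓝[>] 0)
      (fun t => p.eval (Function.update v k (v k + boolSign plus * t)))
      (firstNonzero ((derivList k plus m p).map (·.eval v))) := by
  set s := boolSign plus with hs
  have h0 (q : PolyExpr) : (toPolynomial v k q).eval (v k) = q.eval v := by
    rw [eval_toPolynomial, Function.update_eq_self]
  simp only [← eval_toPolynomial]
  induction m generalizing p with
  | zero =>
    have hc : ∀ t, (toPolynomial v k p).eval t = p.eval v := fun t => by
      rw [← h0 p, Polynomial.eq_C_of_natDegree_le_zero hp, Polynomial.eval_C, Polynomial.eval_C]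
    have e : firstNonzero ((derivList k plus 0 p).map (·.eval v)) = p.eval v := by
      by_cases h : p.eval v = 0 <;> simp [derivList, firstNonzero, h]
    rw [e]
    simp only [hc]
    exact ⟨fun h => .of_forall fun _ => h, fun h => .of_forall fun _ => h,
      fun h => .of_forall fun _ => h⟩
  | succ m ih =>
    have hcont : Tendsto (fun t => (toPolynomial v k p).eval (v k + s * t)) (𝓝[>] 0)
        (𝓝 (p.eval v)) := by
      have : Continuous fun t => (toPolynomial v k p).eval (v k + s * t) := by fun_prop
      have := this.tendsto 0
      rw [mul_zero, add_zero, h0] at this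
      exact this.mono_left nhdsWithin_le_nhds
    simp only [derivList, List.map_cons, firstNonzero]
    by_cases hz : p.eval v = 0
    · rw [if_pos hz]
      -- By the chain rule the direction enters as a factor, so that `p'` is the derivative in `t`.
      set p' := mul (signConst plus) (p.deriv k) with hp'
      have e' : toPolynomial v k p' = Polynomial.C s * (toPolynomial v k p).derivative := by
        rw [hp', toPolynomial, toPolynomial_deriv]
        congr 1
        cases plus <;> simp [signConst, toPolynomial, hs, boolSign]
      have hdeg : (toPolynomial v k p').natDegree ≤ m := by
        rw [e']
        refine (Polynomial.natDegree_C_mul_le _ _).trans ?_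
        exact (Polynomial.natDegree_derivative_le _).trans (by omega)
      obtain ⟨i1, i2, i3⟩ := ih p' hdeg
      have hd (t : ℝ) : HasDerivAt (fun t => (toPolynomial v k p).eval (v k + s * t))
          ((toPolynomial v k p').eval (v k + s * t)) t := by
        have h1 := ((toPolynomial v k p).hasDerivAt (v k + s * t)).comp t
          (((hasDerivAt_id t).const_mul s).const_add (v k))
        rw [e', Polynomial.eval_mul, Polynomial.eval_C, mul_comm]
        rw [mul_one] at h1
        exact h1
      have hf0 : (toPolynomial v k p).eval (v k + s * 0) = 0 := by rw [mul_zero, add_zero, h0, hz]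
      refine ⟨fun h => ?_, fun h => eventually_pos_of_deriv_pos hd hf0 (i2 h), fun h => ?_⟩
      · obtain ⟨u, hu, hsub⟩ := mem_nhdsGT_iff_exists_Ioo_subset.1 (i1 h)
        filter_upwards [Ioo_mem_nhdsGT hu] with t ht
        -- By the mean value theorem, a function with vanishing derivative keeps its value `0` at
        -- `0`.
        obtain ⟨x, hx, hx'⟩ := exists_hasDerivAt_eq_slope _ _ ht.1
          (fun x _ => (hd x).continuousAt.continuousWithinAt) fun x _ => hd x
        have hx0 : (toPolynomial v k p').eval (v k + s * x) = 0 := hsub ⟨hx.1, hx.2.trans ht.2⟩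
        rw [hx0, hf0, eq_comm, div_eq_zero_iff] at hx'
        rcases hx' with h | h <;> linarith [ht.1]
      · have := eventually_pos_of_deriv_pos (fun t => (hd t).neg) (by simpa using hf0)
          ((i3 h).mono fun t ht => neg_pos.2 ht)
        exact this.mono fun t ht => neg_pos.1 ht
    · rw [if_neg hz]
      exact ⟨fun h => (hz h).elim, fun h => hcont.eventually (lt_mem_nhds h),
        fun h => hcont.eventually (gt_mem_nhds h)⟩

/-- Substituting the root expression moves the base point to its value; there the conditions on the
derivatives give the signs to one side. -/
theorem eventually_sat_of_substRootEps (v : ℕ → ℝ) (k : ℕ) (e : RootExpr) (plus : Bool)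
    (hc : 0 ≤ e.c.eval v) (hd : e.d.eval v ≠ 0) {φ : QF} (h : (substRootEps k e plus φ).Sat v) :
    ∀ᶠ t in 𝓝[>] 0, φ.Sat (Function.update v k (e.val v + boolSign plus * t)) := by
  rw [substRootEps, sat_substRoot v k e hc hd] at h
  have := eventually_sat_mapAtoms (G := fun p => derivList k plus (p.deg k) p)
    (fun p => eventuallySign_derivList _ k plus _ p (natDegree_toPolynomial_le _ k p)) h
  simpa using this

end VirtualSubst

/-! ### From pre-EQRs to real points and back -/

namespace VirtualSubst

open PolyExpr QF Filter Topology

/-! ### Variables -/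

theorem PolyExpr.eval_congr {lo hi : ℕ} {v w : ℕ → ℝ} (h : ∀ i, lo ≤ i → i < hi → v i = w i)
    {p : PolyExpr} (hp : p.VarsIn lo hi) : p.eval v = p.eval w := by
  induction p with
  | const z => rfl
  | var i => exact h i hp.1 hp.2
  | add p q h1 h2 => simp only [PolyExpr.eval, h1 hp.1, h2 hp.2]
  | mul p q h1 h2 => simp only [PolyExpr.eval, h1 hp.1, h2 hp.2]

theorem QF.sat_congr {lo hi : ℕ} {v w : ℕ → ℝ} (h : ∀ i, lo ≤ i → i < hi → v i = w i)
    {φ : QF} (hφ : φ.VarsIn lo hi) : φ.Sat v ↔ φ.Sat w := by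
  induction φ with
  | tt => exact Iff.rfl
  | ff => exact Iff.rfl
  | atom p ρ => simp only [Sat, PolyExpr.eval_congr h hφ]
  | and φ χ h1 h2 => exact and_congr (h1 hφ.1) (h2 hφ.2)
  | or φ χ h1 h2 => exact or_congr (h1 hφ.1) (h2 hφ.2)

theorem PolyExpr.VarsIn.mono {lo lo' hi : ℕ} (h : lo' ≤ lo) {p : PolyExpr} (hp : p.VarsIn lo hi) :
    p.VarsIn lo' hi := by
  induction p with
  | const z => trivial
  | var i => exact ⟨h.trans hp.1, hp.2⟩
  | add p q h1 h2 => exact ⟨h1 hp.1, h2 hp.2⟩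
  | mul p q h1 h2 => exact ⟨h1 hp.1, h2 hp.2⟩

theorem QF.VarsIn.mono {lo lo' hi : ℕ} (h : lo' ≤ lo) {φ : QF} (hφ : φ.VarsIn lo hi) :
    φ.VarsIn lo' hi := by
  induction φ with
  | tt => trivial
  | ff => trivial
  | atom p ρ => exact PolyExpr.VarsIn.mono h hφ
  | and φ χ h1 h2 => exact ⟨h1 hφ.1, h2 hφ.2⟩
  | or φ χ h1 h2 => exact ⟨h1 hφ.1, h2 hφ.2⟩

theorem PolyExpr.VarsIn.neg {lo hi : ℕ} {p : PolyExpr} (hp : p.VarsIn lo hi) :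
    p.neg.VarsIn lo hi := ⟨trivial, hp⟩

theorem PolyExpr.VarsIn.sub {lo hi : ℕ} {p q : PolyExpr} (hp : p.VarsIn lo hi)
    (hq : q.VarsIn lo hi) : (p.sub q).VarsIn lo hi := ⟨hp, hq.neg⟩

theorem varsIn_substFrac {n k : ℕ} {e : RootExpr} (he : e.VarsIn (k + 1) n) {p : PolyExpr}
    (hp : p.VarsIn k n) :
    (substFrac k e p).1.VarsIn (k + 1) n ∧ (substFrac k e p).2.1.VarsIn (k + 1) n ∧
      (substFrac k e p).2.2.VarsIn (k + 1) n := by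
  obtain ⟨ha, hb, hc, hd⟩ := he
  induction p with
  | const z => exact ⟨trivial, trivial, trivial⟩
  | var i =>
    by_cases h : i = k
    · simp only [substFrac, h, if_true]
      exact ⟨ha, hb, hd⟩
    · simp only [substFrac, h, if_false]
      obtain ⟨h1, h2⟩ := hp
      exact ⟨⟨by omega, h2⟩, trivial, trivial⟩
  | add p q h1 h2 =>
    obtain ⟨p1, p2, p3⟩ := h1 hp.1
    obtain ⟨q1, q2, q3⟩ := h2 hp.2
    exact ⟨⟨⟨p1, q3⟩, q1, p3⟩, ⟨⟨p2, q3⟩, q2, p3⟩, p3, q3⟩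
  | mul p q h1 h2 =>
    obtain ⟨p1, p2, p3⟩ := h1 hp.1
    obtain ⟨q1, q2, q3⟩ := h2 hp.2
    exact ⟨⟨⟨p1, q1⟩, ⟨p2, q2⟩, hc⟩, ⟨⟨p1, q2⟩, p2, q1⟩, p3, q3⟩

theorem varsIn_rootLt {lo hi : ℕ} {A B C D : PolyExpr} (hA : A.VarsIn lo hi)
    (hB : B.VarsIn lo hi) (hC : C.VarsIn lo hi) (hD : D.VarsIn lo hi) :
    (rootLt A B C D).VarsIn lo hi := by
  have hN : (sub (mul A A) (mul (mul B B) C)).VarsIn lo hi :=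
    PolyExpr.VarsIn.sub ⟨hA, hA⟩ ⟨⟨hB, hB⟩, hC⟩
  exact ⟨⟨⟨hA, hD⟩, hN⟩, ⟨hB, hD⟩, ⟨hA, hD⟩, hN⟩

theorem varsIn_rootLe {lo hi : ℕ} {A B C D : PolyExpr} (hA : A.VarsIn lo hi)
    (hB : B.VarsIn lo hi) (hC : C.VarsIn lo hi) (hD : D.VarsIn lo hi) :
    (rootLe A B C D).VarsIn lo hi := by
  have hN : (sub (mul A A) (mul (mul B B) C)).VarsIn lo hi :=
    PolyExpr.VarsIn.sub ⟨hA, hA⟩ ⟨⟨hB, hB⟩, hC⟩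
  exact ⟨⟨⟨hA, hD⟩, hN⟩, ⟨hB, hD⟩, hN⟩

theorem varsIn_rootAtom {lo hi : ℕ} {A B C D : PolyExpr} (hA : A.VarsIn lo hi)
    (hB : B.VarsIn lo hi) (hC : C.VarsIn lo hi) (hD : D.VarsIn lo hi) (ρ : Rel) :
    (rootAtom A B C D ρ).VarsIn lo hi := by
  have hN : (sub (mul A A) (mul (mul B B) C)).VarsIn lo hi :=
    PolyExpr.VarsIn.sub ⟨hA, hA⟩ ⟨⟨hB, hB⟩, hC⟩
  cases ρ with
  | eq => exact ⟨hN, hA, hB⟩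
  | ne => exact ⟨hN, hA, hB⟩
  | le => exact varsIn_rootLe hA hB hC hD
  | lt => exact varsIn_rootLt hA hB hC hD
  | ge => exact varsIn_rootLe hA.neg hB.neg hC hD
  | gt => exact varsIn_rootLt hA.neg hB.neg hC hD

theorem varsIn_substRoot {n k : ℕ} {e : RootExpr} (he : e.VarsIn (k + 1) n) {φ : QF}
    (hφ : φ.VarsIn k n) : (substRoot k e φ).VarsIn (k + 1) n := by
  induction φ with
  | tt => trivial
  | ff => trivial
  | atom p ρ =>
    obtain ⟨h1, h2, h3⟩ := varsIn_substFrac he hφ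
    exact varsIn_rootAtom h1 h2 he.2.2.1 h3 ρ
  | and φ χ h1 h2 => exact ⟨h1 hφ.1, h2 hφ.2⟩
  | or φ χ h1 h2 => exact ⟨h1 hφ.1, h2 hφ.2⟩

/-! ### Standard schemes with guards that determine the later variables -/

/-- Replace `ε` by `1 / z` and `∞` by `z` (up to sign). -/
def ElimTerm.standardize (z : ℤ) : ElimTerm → ElimTerm
  | root e => root e
  -- This is `(a + b √c) / d + 1 / z` over the common denominator `z d`. The sign in `± ε` is
  -- carried by `z`.
  | rootEps e _ => root ⟨add (mul (const z) e.a) e.d, mul (const z) e.b, e.c, mul (const z) e.d⟩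
  | inf _ => root ⟨const z, const 0, const 0, const 1⟩
  | gthRoot g => gthRoot g

/-- The term for `x_k` is meaningful. -/
def meaningfulFormula (k : ℕ) : ElimTerm → QF
  | .root e => and (atom e.c .ge) (atom e.d .ne)
  | .gthRoot g => if g % 2 = 0 then atom (var (k + 1)) .ge else tt
  | _ => ff

/-- `x_k` equals the given (standard and meaningful) term. -/
def equalsFormula (k : ℕ) : ElimTerm → QF
  | .root e => and
      (atom (sub (mul (sub (mul e.d (var k)) e.a) (sub (mul e.d (var k)) e.a))
        (mul (mul e.b e.b) e.c)) .eq)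
      (atom (mul e.b (sub (mul e.d (var k)) e.a)) .ge)
  | .gthRoot g => and (atom (sub ((mul (var k))^[g] (const 1)) (var (k + 1))) .eq)
      (if g % 2 = 0 then atom (var k) .ge else tt)
  | _ => ff

/-- The standardized scheme for `x_k, x_{k+1}, …` with guards that determine the later variables,
and the formula that determines all variables `x_k, x_{k+1}, …`. -/
def pinnedScheme (zs : ℕ → ℤ) : ℕ → Scheme → Scheme × QF
  | _, [] => ([], tt)
  | k, (e, _) :: S =>
    let r := pinnedScheme zs (k + 1) S
    let e' := e.standardize (zs k)
    ((e', and (meaningfulFormula k e') r.2) :: r.1,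
      and (equalsFormula k e') (and (meaningfulFormula k e') r.2))

theorem ElimTerm.standard_standardize (z : ℤ) (e : ElimTerm) : (e.standardize z).Standard := by
  cases e <;> trivial

theorem ElimTerm.WellFormed.standardize {n k : ℕ} (z : ℤ) {e : ElimTerm} (he : e.WellFormed n k) :
    (e.standardize z).WellFormed n k := by
  cases e with
  | root e => exact he
  | rootEps e plus =>
    obtain ⟨ha, hb, hc, hd⟩ := he
    exact ⟨⟨⟨trivial, ha⟩, hd⟩, ⟨trivial, hb⟩, hc, trivial, hd⟩
  | inf plus => exact ⟨trivial, trivial, trivial, trivial⟩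
  | gthRoot g => exact he

/-- The value of `x_k` is that of the standard term. -/
def ElimTerm.ValueAt (k : ℕ) (v : ℕ → ℝ) : ElimTerm → Prop
  | root e => (0 ≤ e.c.eval v ∧ e.d.eval v ≠ 0) ∧ v k = e.val v
  | gthRoot g => IsRealRoot g (v (k + 1)) (v k)
  | _ => False

theorem meaningful_of_sat (k : ℕ) (v : ℕ → ℝ) (e : ElimTerm)
    (h : (meaningfulFormula k e).Sat v) : e.Meaningful k v := by
  cases e with
  | root e => exact h
  | rootEps e plus => exact h.elim
  | inf plus => trivial
  | gthRoot g =>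
    intro hg
    rw [meaningfulFormula, if_pos (Nat.even_iff.1 hg)] at h
    exact h

theorem sat_equals_and_meaningful (k : ℕ) (v : ℕ → ℝ) (e : ElimTerm) :
    ((equalsFormula k e).Sat v ∧ (meaningfulFormula k e).Sat v) ↔ e.ValueAt k v := by
  cases e with
  | root e =>
    simp only [equalsFormula, meaningfulFormula, Sat, Rel.Holds, PolyExpr.eval, eval_sub,
      ElimTerm.ValueAt, RootExpr.val]
    rw [and_comm]
    refine and_congr_right fun ⟨hc, hd⟩ => ?_
    -- The equation `x_k = (a + b √c) / d` is read as `(d x_k - a) + (-b) √c = 0`.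
    have h := add_mul_sqrt_eq_zero_iff (e.d.eval v * v k - e.a.eval v) (-e.b.eval v) _ hc
    rw [eq_div_iff hd]
    rw [neg_mul_neg] at h
    have h' : e.b.eval v * (e.d.eval v * v k - e.a.eval v) ≥ 0 ↔
        (e.d.eval v * v k - e.a.eval v) * -e.b.eval v ≤ 0 := by
      constructor <;> intro h <;> linarith
    rw [h', ← h]
    constructor <;> intro h <;> linarith
  | rootEps e plus => simp [equalsFormula, Sat, ElimTerm.ValueAt]
  | inf plus => simp [equalsFormula, Sat, ElimTerm.ValueAt]
  | gthRoot g =>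
    simp only [equalsFormula, meaningfulFormula, Sat, ElimTerm.ValueAt, IsRealRoot, Rel.Holds,
      eval_sub, eval_iterate_mul, PolyExpr.eval, sub_eq_zero]
    by_cases hg : g % 2 = 0
    · have hg' := Nat.even_iff.2 hg
      simp only [hg, if_true, Sat, Rel.Holds, PolyExpr.eval, hg', true_imp_iff]
      -- For even `g` the radicand equals `x_k ^ g`, so it is automatically nonnegative.
      refine ⟨fun h => h.1, fun h => ⟨h, ?_⟩⟩
      rw [← h.1]
      exact hg'.pow_nonneg _
    · have hg' : ¬ Even g := fun h => hg (Nat.even_iff.1 h)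
      simp [hg, Sat, hg']

theorem IsRealRoot.unique {g : ℕ} (hg : g ≠ 0) {y r s : ℝ} (hr : IsRealRoot g y r)
    (hs : IsRealRoot g y s) : r = s := by
  have h : r ^ g = s ^ g := hr.1.trans hs.1.symm
  rcases Nat.even_or_odd g with he | ho
  · exact (pow_left_inj₀ (hr.2 he) (hs.2 he) hg).1 h
  · exact ho.strictMono_pow.injective h

theorem exists_isRealRoot {g : ℕ} (hg : g ≠ 0) {y : ℝ} (hy : Even g → 0 ≤ y) :
    ∃ r, IsRealRoot g y r := by
  rcases le_total 0 y with h | h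
  · exact ⟨y ^ (g : ℝ)⁻¹, Real.rpow_inv_natCast_pow h hg, fun _ => Real.rpow_nonneg h _⟩
  · rcases Nat.even_or_odd g with he | ho
    · obtain rfl := le_antisymm h (hy he)
      exact ⟨0, zero_pow hg, fun _ => le_rfl⟩
    · refine ⟨-(-y) ^ (g : ℝ)⁻¹, ?_, fun he => (Nat.not_even_iff_odd.2 ho he).elim⟩
      rw [ho.neg_pow, Real.rpow_inv_natCast_pow (neg_nonneg.2 h) hg, neg_neg]

/-- All rows satisfy `P`. -/
def RowsAll (P : ℕ → ElimTerm → QF → Prop) : ℕ → Scheme → Prop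
  | _, [] => True
  | k, (e, γ) :: S => P k e γ ∧ RowsAll P (k + 1) S

theorem rowsAll_iff (P : ℕ → ElimTerm → QF → Prop) (k : ℕ) (S : Scheme) :
    RowsAll P k S ↔ ∀ j e γ, S[j]? = some (e, γ) → P (k + j) e γ := by
  induction S generalizing k with
  | nil => simp [RowsAll]
  | cons row S ih =>
    obtain ⟨e, γ⟩ := row
    rw [RowsAll, ih]
    constructor
    · rintro ⟨h1, h2⟩ (_ | j) e' γ' h
      · simp only [List.getElem?_cons_zero, Option.some.injEq, Prod.mk.injEq] at h
        obtain ⟨rfl, rfl⟩ := h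
        exact h1
      · have := h2 j e' γ' (by simpa using h)
        rwa [Nat.add_right_comm] at this
    · intro h
      refine ⟨h 0 e γ rfl, fun j e' γ' hj => ?_⟩
      have := h (j + 1) e' γ' (by simpa using hj)
      rwa [Nat.add_right_comm]

theorem varsIn_meaningfulFormula {n k : ℕ} {e : ElimTerm} (he : e.WellFormed n k) :
    (meaningfulFormula k e).VarsIn (k + 1) n := by
  cases e with
  | root e => exact ⟨he.2.2.1, he.2.2.2⟩
  | rootEps e plus => trivial
  | inf plus => trivial
  | gthRoot g =>
    rw [meaningfulFormula]
    split_ifs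
    · exact ⟨le_rfl, he.2⟩
    · trivial

theorem varsIn_equalsFormula {n k : ℕ} (hk : k < n) {e : ElimTerm} (he : e.WellFormed n k) :
    (equalsFormula k e).VarsIn k n := by
  cases e with
  | root e =>
    obtain ⟨ha, hb, hc, hd⟩ := he
    have hk1 := Nat.le_succ k
    have hu : (sub (mul e.d (var k)) e.a).VarsIn k n :=
      PolyExpr.VarsIn.sub ⟨hd.mono hk1, le_rfl, hk⟩ (ha.mono hk1)
    exact ⟨PolyExpr.VarsIn.sub ⟨hu, hu⟩ ⟨⟨hb.mono hk1, hb.mono hk1⟩, hc.mono hk1⟩,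
      hb.mono hk1, hu⟩
  | rootEps e plus => trivial
  | inf plus => trivial
  | gthRoot g =>
    refine ⟨PolyExpr.VarsIn.sub (varsIn_iterate_mul _ _ _ _ ⟨le_rfl, hk⟩)
      ⟨Nat.le_succ k, he.2⟩, ?_⟩
    split_ifs
    · exact ⟨le_rfl, hk⟩
    · trivial

/-! ### Pinned schemes and the points they determine -/

section Pinned

variable {n k : ℕ} {zs : ℕ → ℤ} {S : Scheme}

theorem varsIn_pinnedScheme (hS : RowsAll (fun k e _ => e.WellFormed n k) k S)
    (hn : k + S.length = n) : (pinnedScheme zs k S).2.VarsIn k n := by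
  induction S generalizing k with
  | nil => trivial
  | cons row S ih =>
    obtain ⟨e, γ⟩ := row
    rw [List.length_cons] at hn
    have he := hS.1.standardize (zs k)
    exact ⟨varsIn_equalsFormula (by omega) he,
      (varsIn_meaningfulFormula he).mono (Nat.le_succ k),
      (ih hS.2 (by omega)).mono (Nat.le_succ k)⟩

theorem rowsAll_pinnedScheme (hS : RowsAll (fun k e _ => e.WellFormed n k) k S)
    (hn : k + S.length = n) :
    RowsAll (fun k e γ => (e.WellFormed n k ∧ γ.VarsIn (k + 1) n) ∧
      ∀ v : ℕ → ℝ, γ.Sat v → e.Meaningful k v) k (pinnedScheme zs k S).1 := by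
  induction S generalizing k with
  | nil => trivial
  | cons row S ih =>
    obtain ⟨e, γ⟩ := row
    rw [List.length_cons] at hn
    have he := hS.1.standardize (zs k)
    exact ⟨⟨⟨he, varsIn_meaningfulFormula he, varsIn_pinnedScheme hS.2 (by omega)⟩,
      fun v hv => meaningful_of_sat k v _ hv.1⟩, ih hS.2 (by omega)⟩

theorem length_pinnedScheme : (pinnedScheme zs k S).1.length = S.length := by
  induction S generalizing k with
  | nil => rfl
  | cons row S ih => exact congrArg (· + 1) ih

theorem standard_of_mem_pinnedScheme :
    ∀ row ∈ (pinnedScheme zs k S).1, row.1.Standard := by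
  induction S generalizing k with
  | nil => simp [pinnedScheme]
  | cons row S ih =>
    simp only [pinnedScheme, List.forall_mem_cons]
    exact ⟨ElimTerm.standard_standardize _ _, ih⟩

/-- The integer for `x_k` can thus be chosen after those for the later variables without changing
their rows. -/
theorem pinnedScheme_congr {zs' : ℕ → ℤ} (h : ∀ i, k ≤ i → zs i = zs' i) :
    pinnedScheme zs k S = pinnedScheme zs' k S := by
  induction S generalizing k with
  | nil => rfl
  | cons row S ih =>
    simp only [pinnedScheme, h k le_rfl]
    rw [ih fun i hi => h i (by omega)]

theorem sat_pinnedScheme_cons (e : ElimTerm) (γ : QF) (v : ℕ → ℝ) :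
    (pinnedScheme zs k ((e, γ) :: S)).2.Sat v ↔
      (e.standardize (zs k)).ValueAt k v ∧ (pinnedScheme zs (k + 1) S).2.Sat v := by
  rw [← sat_equals_and_meaningful, and_assoc]
  exact Iff.rfl

theorem RootExpr.val_congr {lo hi : ℕ} {v w : ℕ → ℝ} (h : ∀ i, lo ≤ i → i < hi → v i = w i)
    {e : RootExpr} (he : e.VarsIn lo hi) : e.val v = e.val w := by
  obtain ⟨ha, hb, hc, hd⟩ := he
  simp only [RootExpr.val, PolyExpr.eval_congr h ha, PolyExpr.eval_congr h hb,
    PolyExpr.eval_congr h hc, PolyExpr.eval_congr h hd]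

theorem ElimTerm.ValueAt.unique {v w : ℕ → ℝ} (h : ∀ i, k + 1 ≤ i → i < n → v i = w i)
    {e : ElimTerm} (he : e.WellFormed n k) (hv : e.ValueAt k v) (hw : e.ValueAt k w) :
    v k = w k := by
  cases e with
  | root e => rw [hv.2, hw.2, RootExpr.val_congr h he]
  | rootEps e plus => exact hv.elim
  | inf plus => exact hv.elim
  | gthRoot g =>
    refine IsRealRoot.unique he.1 hv ?_
    rw [h _ le_rfl he.2]
    exact hw

/-- Each term is a function of the later variables, so the values are forced from the last variable
down. -/
theorem eq_of_sat_pinnedScheme (hS : RowsAll (fun k e _ => e.WellFormed n k) k S)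
    (hn : k + S.length = n) {v w : ℕ → ℝ} (hv : (pinnedScheme zs k S).2.Sat v)
    (hw : (pinnedScheme zs k S).2.Sat w) : ∀ i, k ≤ i → i < n → v i = w i := by
  induction S generalizing k with
  | nil =>
    intro i h1 h2
    rw [List.length_nil] at hn
    omega
  | cons row S ih =>
    obtain ⟨e, γ⟩ := row
    rw [List.length_cons] at hn
    rw [sat_pinnedScheme_cons] at hv hw
    have h := ih hS.2 (by omega) hv.2 hw.2
    intro i h1 h2
    rcases h1.eq_or_lt with rfl | h1
    · exact ElimTerm.ValueAt.unique h (hS.1.standardize _) hv.1 hw.1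
    · exact h i h1 h2

/-- A point at which `φ` is true and which is described by the pinned scheme. -/
theorem substTrue_pinnedScheme (hS : RowsAll (fun k e _ => e.WellFormed n k) k S)
    (hn : k + S.length = n) {φ : QF} (hφ : φ.VarsIn k n) {x : ℕ → ℝ} (hx : φ.Sat x)
    (hpin : (pinnedScheme zs k S).2.Sat x) : SubstTrue n k φ (pinnedScheme zs k S).1 := by
  induction S generalizing k φ with
  | nil =>
    rw [List.length_nil, add_zero] at hn
    subst hn
    intro v
    exact (QF.sat_congr (fun i h1 h2 => by omega) hφ).1 hx
  | cons row S ih =>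
    obtain ⟨e, γ⟩ := row
    rw [List.length_cons] at hn
    have hγ : (and (meaningfulFormula k (e.standardize (zs k)))
        (pinnedScheme zs (k + 1) S).2).Sat x := hpin.2
    have he := hS.1.standardize (zs k)
    have hγn : (and (meaningfulFormula k (e.standardize (zs k)))
        (pinnedScheme zs (k + 1) S).2).VarsIn (k + 1) n :=
      ⟨varsIn_meaningfulFormula he, varsIn_pinnedScheme hS.2 (by omega)⟩
    rw [sat_pinnedScheme_cons] at hpin
    obtain ⟨hval, hpin⟩ := hpin
    -- Every point that satisfies the new guard agrees with `x` in the later variables.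
    have hu := fun v => eq_of_sat_pinnedScheme (zs := zs) hS.2 (by omega) (v := v) (w := x)
    simp only [pinnedScheme, SubstTrue]
    generalize e.standardize (zs k) = e' at *
    cases e' with
    | root e =>
      refine ⟨_, rfl, ih hS.2 (by omega) ⟨hγn, varsIn_substRoot he hφ⟩ ⟨hγ, ?_⟩ hpin⟩
      -- The coordinate `x k` already is the value of the term, so plugging it in changes nothing.
      rw [sat_substRoot x k e hval.1.1 hval.1.2, ← hval.2, Function.update_eq_self]
      exact hx
    | rootEps e plus => exact hval.elim
    | inf plus => exact hval.elim
    | gthRoot g =>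
      -- Under the guard the later variables are those of `x`, hence the root is `x k`, and there
      -- `φ` is true. So `tt` is a correct result of the substitution.
      refine ⟨tt, ⟨trivial, fun v r hv hr => ⟨fun _ => ?_, fun _ => trivial⟩⟩,
        ih hS.2 (by omega) ⟨hγn, trivial⟩ ⟨hγ, trivial⟩ hpin⟩
      have hvx := hu v hv.2 hpin
      refine (QF.sat_congr (fun i h1 h2 => ?_) hφ).1 hx
      rcases h1.eq_or_lt with rfl | h1
      · rw [Function.update_self]
        refine IsRealRoot.unique he.1 hval ?_
        rw [← hvx _ le_rfl he.2]
        exact hr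
      · rw [Function.update_of_ne h1.ne', hvx i h1 h2]

theorem eventually_atTop_intCast_inv (plus : Bool) {P : ℝ → Prop}
    (h : ∀ᶠ t in 𝓝[>] (0 : ℝ), P (boolSign plus * t)) : ∃ z : ℤ, z ≠ 0 ∧ P (z : ℝ)⁻¹ := by
  have ht : Tendsto (fun m : ℕ => ((m : ℝ) + 1)⁻¹) atTop (𝓝[>] 0) := by
    refine tendsto_nhdsWithin_iff.2 ⟨?_, .of_forall fun m => by simp; positivity⟩
    simpa using tendsto_one_div_add_atTop_nhds_zero_nat (𝕜 := ℝ)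
  obtain ⟨m, hm⟩ := (ht.eventually h).exists
  cases plus with
  | true => exact ⟨m + 1, by omega, by simpa [boolSign] using hm⟩
  | false =>
    refine ⟨-(m + 1), by omega, ?_⟩
    rw [Int.cast_neg, inv_neg]
    simpa [boolSign] using hm

/-- The induction provides a point for the later variables at which the guard and the substituted
formula hold. Only a value of `x_k` and, in the nonstandard cases, an integer that realizes it
remain to be found. -/
theorem exists_pinned_point (hS : RowsAll (fun k e γ => (e.WellFormed n k ∧ γ.VarsIn (k + 1) n) ∧
      ∀ v : ℕ → ℝ, γ.Sat v → e.Meaningful k v) k S)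
    (hS' : RowsAll (fun k e _ => e.WellFormed n k) k S)
    (hn : k + S.length = n) {φ : QF} (h : SubstTrue n k φ S) :
    ∃ (zs : ℕ → ℤ) (x : ℕ → ℝ), φ.Sat x ∧ (pinnedScheme zs k S).2.Sat x := by
  induction S generalizing k φ with
  | nil => exact ⟨0, 0, h 0, trivial⟩
  | cons row S ih =>
    obtain ⟨e, γ⟩ := row
    rw [List.length_cons] at hn
    obtain ⟨χ, hχ, h⟩ := h
    obtain ⟨zs, x, ⟨hγ, hx⟩, hpin⟩ := ih hS.2 hS'.2 (by omega) h
    have hm := hS.1.2 x hγ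
    have he := hS'.1
    -- Changing `x_k` does not affect the later rows, in which it does not occur.
    suffices ∃ (z : ℤ) (r : ℝ), φ.Sat (Function.update x k r) ∧
        (e.standardize z).ValueAt k (Function.update x k r) by
      obtain ⟨z, r, h1, h2⟩ := this
      refine ⟨Function.update zs k z, Function.update x k r, h1, ?_⟩
      rw [sat_pinnedScheme_cons, Function.update_self]
      refine ⟨h2, ?_⟩
      rw [pinnedScheme_congr (zs' := zs) fun i hi => Function.update_of_ne (by omega) _ _]
      refine (QF.sat_congr (fun i h1 h2 => ?_) (varsIn_pinnedScheme hS'.2 (by omega))).1 hpin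
      rw [Function.update_of_ne (by omega)]
    have hup (r : ℝ) : ∀ i, k + 1 ≤ i → i < n → x i = Function.update x k r i :=
      fun i h1 h2 => by rw [Function.update_of_ne (by omega)]
    have hroot {e : RootExpr} (he : e.VarsIn (k + 1) n) (hm : 0 ≤ e.c.eval x ∧ e.d.eval x ≠ 0) :
        (ElimTerm.root e).ValueAt k (Function.update x k (e.val x)) := by
      refine ⟨?_, ?_⟩
      · rwa [← PolyExpr.eval_congr (hup _) he.2.2.1, ← PolyExpr.eval_congr (hup _) he.2.2.2]
      · rw [Function.update_self]
        exact RootExpr.val_congr (hup _) he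
    cases e with
    | root e =>
      -- Standardization leaves the term unchanged, so the integer is arbitrary.
      refine ⟨0, e.val x, ?_, hroot he hm⟩
      obtain rfl : χ = substRoot k e φ := hχ
      exact (sat_substRoot x k e hm.1 hm.2 φ).1 hx
    | rootEps e plus =>
      obtain rfl : χ = substRootEps k e plus φ := hχ
      obtain ⟨z, hz, h1⟩ := eventually_atTop_intCast_inv plus
        (P := fun t => φ.Sat (Function.update x k (e.val x + t)))
        (eventually_sat_of_substRootEps x k e plus hm.1 hm.2 hx)
      have hz' : (z : ℝ) ≠ 0 := Int.cast_ne_zero.2 hz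
      have hwf := ElimTerm.WellFormed.standardize z (e := .rootEps e plus) he
      refine ⟨z, e.val x + (z : ℝ)⁻¹, h1, ?_⟩
      have hval : RootExpr.val x ⟨add (mul (const z) e.a) e.d, mul (const z) e.b, e.c,
          mul (const z) e.d⟩ = e.val x + (z : ℝ)⁻¹ := by
        have := hm.2
        simp only [RootExpr.val, PolyExpr.eval]
        field_simp
        ring
      rw [← hval]
      exact hroot hwf ⟨hm.1, mul_ne_zero hz' hm.2⟩
    | inf plus =>
      obtain rfl : χ = substInf k plus φ := hχ
      have h1 := eventually_sat_of_substInf x k plus hx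
      obtain ⟨m, hm'⟩ := (tendsto_natCast_atTop_atTop.eventually h1).exists
      refine ⟨if plus then m else -m, boolSign plus * m, hm', ?_⟩
      have hwf := ElimTerm.WellFormed.standardize (if plus then m else -m : ℤ)
        (e := .inf plus) he
      have hval : RootExpr.val x ⟨const (if plus then m else -m : ℤ), const 0, const 0,
          const 1⟩ = boolSign plus * m := by
        cases plus <;> simp [RootExpr.val, PolyExpr.eval, boolSign]
      rw [← hval]
      exact hroot hwf ⟨by simp [PolyExpr.eval], by simp [PolyExpr.eval]⟩
    | gthRoot g =>
      obtain ⟨r, hr⟩ := exists_isRealRoot he.1 hm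
      refine ⟨0, r, (hχ.2 x r hγ hr).1 hx, ?_⟩
      change IsRealRoot g (Function.update x k r (k + 1)) (Function.update x k r k)
      rwa [Function.update_self, Function.update_of_ne (by omega)]

end Pinned

end VirtualSubst

namespace VirtualSubst

open PolyExpr QF Filter Topology Polynomial

/-! ### Soundness of certificates -/

/-- The polynomial with a given coefficient list. -/
noncomputable def listPoly (l : List ℕ) : ℕ[X] := l.foldr (fun a P => C a + X * P) 0

theorem eval_listPoly (l : List ℕ) (t : ℕ) : (listPoly l).eval t = horner l t := by
  induction l with
  | nil => simp [listPoly, horner]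
  | cons a l ih =>
    simp only [listPoly, horner, List.foldr_cons, eval_add, eval_C, eval_mul, eval_X] at ih ⊢
    rw [ih]

theorem exists_listPoly_eq (P : ℕ[X]) : ∃ l, listPoly l = P := by
  induction h : P.natDegree using Nat.strong_induction_on generalizing P with
  | _ d ih =>
    by_cases hd : d = 0
    · refine ⟨[P.coeff 0], ?_⟩
      rw [eq_C_of_natDegree_eq_zero (h.trans hd)]
      simp [listPoly]
    · obtain ⟨l, hl⟩ := ih (d - 1) (by omega) P.divX
        (by rw [natDegree_divX_eq_natDegree_tsub_one, h])
      refine ⟨P.coeff 0 :: l, ?_⟩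
      conv_rhs => rw [← divX_mul_X_add P, ← hl]
      rw [listPoly, List.foldr_cons, ← listPoly]
      ring

/-- Two polynomials over `ℕ` agree if they agree at an argument that exceeds their sums of
coefficients. -/
theorem natPoly_eq_of_eval_eq {B : ℕ} {P Q : ℕ[X]} (hP : P.eval 1 < B) (hQ : Q.eval 1 < B)
    (h : P.eval B = Q.eval B) : P = Q := by
  induction hd : P.natDegree + Q.natDegree using Nat.strong_induction_on generalizing P Q with
  | _ d ih =>
    have key (P : ℕ[X]) (x : ℕ) : P.eval x = P.divX.eval x * x + P.coeff 0 := by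
      conv_lhs => rw [← divX_mul_X_add P]
      simp
    -- By the bounds at `1`, all coefficients are below `B`: they are the base `B` digits of the
    -- value at `B`. The constant coefficient is the last digit.
    have hP1 := key P 1
    have hQ1 := key Q 1
    rw [key P B, key Q B] at h
    have h0 : P.coeff 0 = Q.coeff 0 := by
      have := congrArg (· % B) h
      simpa [Nat.mod_eq_of_lt (show P.coeff 0 < B by omega),
        Nat.mod_eq_of_lt (show Q.coeff 0 < B by omega)] using this
    have h1 : P.divX.eval B = Q.divX.eval B := by
      rw [h0, Nat.add_right_cancel_iff] at h
      exact Nat.eq_of_mul_eq_mul_right (by omega) h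
    by_cases hz : d = 0
    · rw [eq_C_of_natDegree_eq_zero (p := P) (by omega),
        eq_C_of_natDegree_eq_zero (p := Q) (by omega), h0]
    · have h2 : P.divX = Q.divX := by
        refine ih _ ?_ (by omega) (by omega) h1 rfl
        rw [natDegree_divX_eq_natDegree_tsub_one, natDegree_divX_eq_natDegree_tsub_one]
        omega
      rw [← divX_mul_X_add P, ← divX_mul_X_add Q, h0, h2]

/-- The coordinates as polynomials. -/
noncomputable def coordPoly (A : List FracPoly) (i : ℕ) : ℕ[X] × ℕ[X] × ℕ[X] :=
  (listPoly (A.getD i ([], [], 0)).1, listPoly (A.getD i ([], [], 0)).2.1,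
    C ((A.getD i ([], [], 0)).2.2 + 1))

theorem evalTriple_coordTriple (A : List FracPoly) (t : ℕ) (p : PolyExpr) :
    evalTriple (coordTriple A t) p = ((evalTriple (coordPoly A) p).1.eval t,
      (evalTriple (coordPoly A) p).2.1.eval t, (evalTriple (coordPoly A) p).2.2.eval t) := by
  have h := map_evalTriple (evalRingHom t) (coordPoly A) p
  simp only [coe_evalRingHom] at h
  rw [← h]
  congr 1
  funext i
  simp [coordTriple, coordPoly, eval_listPoly]

theorem evalTriple_aeval (A : List FracPoly) (θ : ℝ) (p : PolyExpr) :
    evalTriple (fun i => (aeval θ (coordPoly A i).1, aeval θ (coordPoly A i).2.1,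
      aeval θ (coordPoly A i).2.2)) p = (aeval θ (evalTriple (coordPoly A) p).1,
      aeval θ (evalTriple (coordPoly A) p).2.1, aeval θ (evalTriple (coordPoly A) p).2.2) :=
  map_evalTriple (aeval θ : ℕ[X] →ₐ[ℕ] ℝ).toRingHom (coordPoly A) p

theorem eval_eq_evalTriple {u : ℕ → ℝ × ℝ × ℝ} {v : ℕ → ℝ}
    (hu : ∀ i, 0 < (u i).2.2 ∧ v i = ((u i).1 - (u i).2.1) / (u i).2.2) (p : PolyExpr) : 0 < (evalTriple u p).2.2 ∧
      p.eval v = ((evalTriple u p).1 - (evalTriple u p).2.1) / (evalTriple u p).2.2 := by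
  induction p with
  | const z =>
    refine ⟨one_pos, ?_⟩
    have h := congrArg (Int.cast (R := ℝ)) (Int.toNat_sub_toNat_neg z)
    rw [Int.cast_sub, Int.cast_natCast, Int.cast_natCast] at h
    simp only [evalTriple, PolyExpr.eval, h, div_one]
  | var i => exact hu i
  | add p q hp hq =>
    obtain ⟨p0, p1⟩ := hp
    obtain ⟨q0, q1⟩ := hq
    refine ⟨mul_pos p0 q0, ?_⟩
    simp only [PolyExpr.eval, p1, q1, evalTriple, tripleAdd]
    field_simp
    ring
  | mul p q hp hq =>
    obtain ⟨p0, p1⟩ := hp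
    obtain ⟨q0, q1⟩ := hq
    refine ⟨mul_pos p0 q0, ?_⟩
    simp only [PolyExpr.eval, p1, q1, evalTriple, tripleMul]
    field_simp
    ring

/-- The coefficients are nonnegative. This is why numerators are split into two polynomials over `ℕ`
and why `θ` is taken positive. -/
theorem aeval_natPoly_mono {a b : ℝ} (ha : 0 ≤ a) (hab : a ≤ b) (P : ℕ[X]) :
    0 ≤ aeval a P ∧ aeval a P ≤ aeval b P := by
  induction P using Polynomial.induction_on' with
  | add P Q hP hQ =>
    simp only [map_add]
    exact ⟨add_nonneg hP.1 hQ.1, add_le_add hP.2 hQ.2⟩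
  | monomial m c =>
    simp only [aeval_monomial]
    exact ⟨mul_nonneg (by simp) (pow_nonneg ha _),
      mul_le_mul_of_nonneg_left (pow_le_pow_left₀ ha hab _) (by simp)⟩

theorem aeval_natCast (P : ℕ[X]) (t : ℕ) : aeval (t : ℝ) P = ((P.eval t : ℕ) : ℝ) := by
  rw [aeval_def, eval₂_at_natCast, eq_natCast, Nat.cast_id]

/-- The coordinates at `θ`. -/
noncomputable def certPoint (C : Cert) (θ : ℝ) (i : ℕ) : ℝ :=
  (aeval θ (coordPoly C.2.2.1 i).1 - aeval θ (coordPoly C.2.2.1 i).2.1) /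
    aeval θ (coordPoly C.2.2.1 i).2.2

theorem eval_certPoint (C : Cert) (θ : ℝ) (p : PolyExpr) :
    0 < aeval θ (evalTriple (coordPoly C.2.2.1) p).2.2 ∧
      p.eval (certPoint C θ) = (aeval θ (evalTriple (coordPoly C.2.2.1) p).1 -
        aeval θ (evalTriple (coordPoly C.2.2.1) p).2.1) /
        aeval θ (evalTriple (coordPoly C.2.2.1) p).2.2 := by
  have h := eval_eq_evalTriple (u := fun i => (aeval θ (coordPoly C.2.2.1 i).1,
      aeval θ (coordPoly C.2.2.1 i).2.1, aeval θ (coordPoly C.2.2.1 i).2.2))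
      (v := certPoint C θ) (fun i => ⟨?_, rfl⟩) p
  · rwa [evalTriple_aeval] at h
  · simp only [coordPoly, aeval_C]
    simp
    positivity

/-- The intermediate value theorem. Uniqueness of the root is not needed, as the sign certificates
are valid on the whole interval. -/
theorem exists_root_of_rootCert {C : Cert} (h : RootCert C) :
    ∃ θ : ℝ, (C.2.1 : ℝ) ≤ θ ∧ θ ≤ (C.2.1 : ℝ) + 2 ∧
      aeval θ (listPoly C.1.1) = aeval θ (listPoly C.1.2) := by
  have hcont : ContinuousOn (fun t : ℝ => aeval t (listPoly C.1.1) - aeval t (listPoly C.1.2))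
      (Set.Icc (C.2.1 : ℝ) (C.2.1 + 2)) := by
    exact ((listPoly C.1.1).continuous_aeval.sub (listPoly C.1.2).continuous_aeval).continuousOn
  obtain ⟨h1, h2⟩ := h
  have e : (C.2.1 : ℝ) + 2 = ((C.2.1 + 2 : ℕ) : ℝ) := by push_cast; ring
  have h0 := intermediate_value_Icc (by linarith) hcont (show (0 : ℝ) ∈ Set.Icc _ _ from ?_)
  · obtain ⟨θ, hθ, h⟩ := h0
    exact ⟨θ, hθ.1, hθ.2, sub_eq_zero.1 h⟩
  · rw [e]
    simp only [aeval_natCast, eval_listPoly, Set.mem_Icc, sub_nonpos, sub_nonneg, Nat.cast_le]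
    exact ⟨h1.le, h2.le⟩

/-- The two sides of the identity `(c + 1) P = M K`, sorted by sign. -/
noncomputable def quotPolys (C : Cert) (p : PolyExpr) (K : FracPoly) : ℕ[X] × ℕ[X] :=
  (Polynomial.C (K.2.2 + 1) * (evalTriple (coordPoly C.2.2.1) p).1 +
      (listPoly C.1.1 * listPoly K.2.1 + listPoly C.1.2 * listPoly K.1),
    Polynomial.C (K.2.2 + 1) * (evalTriple (coordPoly C.2.2.1) p).2.1 +
      (listPoly C.1.1 * listPoly K.1 + listPoly C.1.2 * listPoly K.2.1))

theorem quotSides_code (C : Cert) (p : PolyExpr) (K : FracPoly) (t : ℕ) :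
    quotSides C p.code K t = ((quotPolys C p K).1.eval t, (quotPolys C p K).2.eval t) := by
  simp only [quotSides, quotPolys, evalCode_code, evalTriple_coordTriple, eval_add, eval_mul,
    eval_C, eval_listPoly]

/-- The values at `1` are the sums of coefficients, so the test argument exceeds both. -/
theorem isQuot_code_iff (C : Cert) (p : PolyExpr) (K : FracPoly) :
    IsQuot C p.code K ↔ (quotPolys C p K).1 = (quotPolys C p K).2 := by
  simp only [IsQuot, quotSides_code]
  exact ⟨natPoly_eq_of_eval_eq (by omega) (by omega), fun h => by rw [h]⟩

section Sound

variable {C : Cert} {θ : ℝ}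

/-- At a root of `M` its two parts coincide, and the terms with the quotient cancel in the identity.
-/
theorem eval_eq_zero_of_zeroCert (hθ : aeval θ (listPoly C.1.1) = aeval θ (listPoly C.1.2))
    {p : PolyExpr} (h : ZeroCert C p.code) : p.eval (certPoint C θ) = 0 := by
  obtain ⟨K, -, hK⟩ := h
  have h := congrArg (aeval θ) ((isQuot_code_iff C p K).1 hK)
  simp only [quotPolys, map_add, map_mul, hθ, aeval_C] at h
  have hc : (algebraMap ℕ ℝ) K.2.2 + (algebraMap ℕ ℝ) 1 ≠ 0 := by
    simp only [eq_natCast, Nat.cast_one]; positivity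
  rw [(eval_certPoint C θ p).2, div_eq_zero_iff]
  left
  refine (mul_eq_zero.1 ?_).resolve_left hc
  linear_combination h

theorem eval_pos_of_posCert (hlo : (C.2.1 : ℝ) ≤ θ) (hhi : θ ≤ (C.2.1 : ℝ) + 2)
    {p : PolyExpr} (h : PosCert C p.code) : 0 < p.eval (certPoint C θ) := by
  obtain ⟨h1, h2⟩ := eval_certPoint C θ p
  simp only [PosCert, evalCode_code, evalTriple_coordTriple] at h
  have h3 := (aeval_natPoly_mono (Nat.cast_nonneg _) hlo (evalTriple (coordPoly C.2.2.1) p).1).2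
  have h4 := (aeval_natPoly_mono ((Nat.cast_nonneg _).trans hlo) hhi
    (evalTriple (coordPoly C.2.2.1) p).2.1).2
  have e : (C.2.1 : ℝ) + 2 = ((C.2.1 + 2 : ℕ) : ℝ) := by push_cast; ring
  rw [aeval_natCast] at h3
  rw [e, aeval_natCast] at h4
  have h5 := (Nat.cast_lt (α := ℝ)).2 h
  rw [h2]
  exact div_pos (by linarith) h1

theorem eval_neg_of_negCert (hlo : (C.2.1 : ℝ) ≤ θ) (hhi : θ ≤ (C.2.1 : ℝ) + 2)
    {p : PolyExpr} (h : NegCert C p.code) : p.eval (certPoint C θ) < 0 := by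
  obtain ⟨h1, h2⟩ := eval_certPoint C θ p
  simp only [NegCert, evalCode_code, evalTriple_coordTriple] at h
  have h3 := (aeval_natPoly_mono (Nat.cast_nonneg _) hlo (evalTriple (coordPoly C.2.2.1) p).2.1).2
  have h4 := (aeval_natPoly_mono ((Nat.cast_nonneg _).trans hlo) hhi
    (evalTriple (coordPoly C.2.2.1) p).1).2
  have e : (C.2.1 : ℝ) + 2 = ((C.2.1 + 2 : ℕ) : ℝ) := by push_cast; ring
  rw [aeval_natCast] at h3
  rw [e, aeval_natCast] at h4
  have h5 := (Nat.cast_lt (α := ℝ)).2 h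
  rw [h2]
  exact div_neg_of_neg_of_pos (by linarith) h1

theorem satCode_atom (C : Cert) (p : PolyExpr) (ρ : Rel) :
    satCode C (atom p ρ).code = true ↔ RelCert C p.code ρ.code := by
  rw [QF.code, satCode, treeRec_leaf _ _ _ _ _ (by norm_num)]
  simp

theorem satCode_and (C : Cert) (φ χ : QF) :
    satCode C (and φ χ).code = true ↔ satCode C φ.code = true ∧ satCode C χ.code = true := by
  rw [QF.code, satCode, treeRec_node _ _ _ _ _ _ (by norm_num)]
  simp [satCode]

theorem satCode_or (C : Cert) (φ χ : QF) :
    satCode C (or φ χ).code = true ↔ satCode C φ.code = true ∨ satCode C χ.code = true := by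
  rw [QF.code, satCode, treeRec_node _ _ _ _ _ _ (by norm_num)]
  simp [satCode]

theorem satCode_tt (C : Cert) : satCode C tt.code = true := by
  rw [QF.code, satCode, treeRec_leaf _ _ _ _ _ (by norm_num)]
  simp

theorem satCode_ff (C : Cert) : satCode C ff.code = false := by
  rw [QF.code, satCode, treeRec_leaf _ _ _ _ _ (by norm_num)]
  simp

theorem sat_of_satCode (hθ : aeval θ (listPoly C.1.1) = aeval θ (listPoly C.1.2))
    (hlo : (C.2.1 : ℝ) ≤ θ) (hhi : θ ≤ (C.2.1 : ℝ) + 2) {φ : QF}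
    (h : satCode C φ.code = true) : φ.Sat (certPoint C θ) := by
  induction φ with
  | tt => trivial
  | ff => rw [satCode_ff] at h; cases h
  | atom p ρ =>
    rw [satCode_atom] at h
    rcases h with ⟨h1, h2⟩ | ⟨h1, h2⟩ | ⟨h1, h2⟩
    · have := eval_eq_zero_of_zeroCert hθ h2
      cases ρ <;> simp [Rel.code] at h1 <;> simp [Sat, Rel.Holds, this]
    · have := eval_pos_of_posCert hlo hhi h2
      cases ρ <;> simp [Rel.code] at h1 <;> simp [Sat, Rel.Holds, this, this.le, this.ne']
    · have := eval_neg_of_negCert hlo hhi h2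
      cases ρ <;> simp [Rel.code] at h1 <;> simp [Sat, Rel.Holds, this, this.le, this.ne]
  | and φ χ h1 h2 =>
    rw [satCode_and] at h
    exact ⟨h1 h.1, h2 h.2⟩
  | or φ χ h1 h2 =>
    rw [satCode_or] at h
    exact h.imp h1 h2

end Sound

end VirtualSubst

namespace VirtualSubst

open PolyExpr QF Filter Topology Polynomial

/-! ### Completeness of certificates -/

theorem isAlgebraic_eval {lo hi : ℕ} {v : ℕ → ℝ}
    (h : ∀ i, lo ≤ i → i < hi → IsAlgebraic ℚ (v i)) {p : PolyExpr} (hp : p.VarsIn lo hi) :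
    IsAlgebraic ℚ (p.eval v) := by
  induction p with
  | const z => exact isAlgebraic_intCast z
  | var i => exact h i hp.1 hp.2
  | add p q h1 h2 => exact (h1 hp.1).add (h2 hp.2)
  | mul p q h1 h2 => exact (h1 hp.1).mul (h2 hp.2)

/-- From the last variable down, each coordinate arises from later ones and integers by field
operations and roots. -/
theorem isAlgebraic_of_sat_pinnedScheme {n k : ℕ} {zs : ℕ → ℤ} {S : Scheme}
    (hS : RowsAll (fun k e _ => e.WellFormed n k) k S) (hn : k + S.length = n) {v : ℕ → ℝ}
    (hv : (pinnedScheme zs k S).2.Sat v) : ∀ i, k ≤ i → i < n → IsAlgebraic ℚ (v i) := by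
  induction S generalizing k with
  | nil =>
    intro i h1 h2
    rw [List.length_nil] at hn
    omega
  | cons row S ih =>
    obtain ⟨e, γ⟩ := row
    rw [List.length_cons] at hn
    rw [sat_pinnedScheme_cons] at hv
    have h := ih hS.2 (by omega) hv.2
    have he := hS.1.standardize (zs k)
    have hval := hv.1
    intro i h1 h2
    rcases h1.eq_or_lt with rfl | h1
    · generalize e.standardize (zs k) = e' at *
      cases e' with
      | root e =>
        obtain ⟨ha, hb, hc, hd⟩ := he
        have hs : IsAlgebraic ℚ √(e.c.eval v) := by
          refine IsAlgebraic.of_pow two_pos ?_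
          rw [Real.sq_sqrt hval.1.1]
          exact isAlgebraic_eval h hc
        rw [hval.2, RootExpr.val, div_eq_mul_inv]
        exact ((isAlgebraic_eval h ha).add ((isAlgebraic_eval h hb).mul hs)).mul
          (isAlgebraic_eval h hd).inv
      | rootEps e plus => exact hval.elim
      | inf plus => exact hval.elim
      | gthRoot g =>
        refine IsAlgebraic.of_pow (Nat.pos_of_ne_zero he.1) ?_
        rw [hval.1]
        exact h _ le_rfl he.2
    · exact h i h1 h2

/-- A primitive element of the number field generated by the coordinates, shifted by a natural
number to become positive. -/
theorem exists_pos_generator {n : ℕ} {x : ℕ → ℝ} (hx : ∀ i < n, IsAlgebraic ℚ (x i)) :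
    ∃ (θ : ℝ) (A : ℕ → ℚ[X]), 0 < θ ∧ IsAlgebraic ℚ θ ∧ ∀ i < n, aeval θ (A i) = x i := by
  let E := IntermediateField.adjoin ℚ (x '' Set.Iio n)
  have hfin : FiniteDimensional ℚ E := by
    have : Finite (x '' Set.Iio n) := ((Set.finite_Iio n).image x).to_subtype
    refine IntermediateField.finiteDimensional_adjoin ?_
    rintro _ ⟨i, hi, rfl⟩
    exact (hx i hi).isIntegral
  obtain ⟨α, hα⟩ := Field.exists_primitive_element ℚ E
  have halg : IsAlgebraic ℚ α := IsAlgebraic.of_finite ℚ α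
  have hgen (y : E) : ∃ q : ℚ[X], aeval (α : ℝ) q = y := by
    have hy : y ∈ (IntermediateField.adjoin ℚ {α}).toSubalgebra := by
      rw [hα]; trivial
    rw [IntermediateField.adjoin_simple_toSubalgebra_of_isAlgebraic halg,
      Algebra.adjoin_singleton_eq_range_aeval] at hy
    obtain ⟨q, hq⟩ := hy
    refine ⟨q, ?_⟩
    rw [← hq]
    exact Polynomial.aeval_algebraMap_apply ℝ α q
  obtain ⟨m, hm⟩ := exists_nat_gt (-(α : ℝ))
  have hA : ∀ i, ∃ q : ℚ[X], i < n → aeval ((α : ℝ) + m) q = x i := by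
    intro i
    by_cases hi : i < n
    · obtain ⟨q, hq⟩ := hgen ⟨x i, IntermediateField.subset_adjoin _ _ ⟨i, hi, rfl⟩⟩
      refine ⟨q.comp (X - C (m : ℚ)), fun _ => ?_⟩
      rw [aeval_comp]
      simpa using hq
    · exact ⟨0, fun h => (hi h).elim⟩
  choose A hA using hA
  refine ⟨α + m, A, by linarith, ?_, hA⟩
  exact (halg.algebraMap (A := ℝ)).add (isAlgebraic_natCast m)

/-- Monomial by monomial: the denominator is cleared and the numerator split into its positive and
negative part. -/
theorem exists_sub_natPoly (q : ℚ[X]) : ∃ (P Q : ℕ[X]) (d : ℕ), 0 < d ∧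
    C (d : ℚ) * q = P.map (Nat.castRingHom ℚ) - Q.map (Nat.castRingHom ℚ) := by
  induction q using Polynomial.induction_on' with
  | add q r hq hr =>
    obtain ⟨P, Q, d, hd, h⟩ := hq
    obtain ⟨P', Q', d', hd', h'⟩ := hr
    refine ⟨d' * P + d * P', d' * Q + d * Q', d * d', mul_pos hd hd', ?_⟩
    simp only [Polynomial.map_add, Polynomial.map_mul, Polynomial.map_natCast, Nat.cast_mul, C_mul,
      map_natCast] at h h' ⊢
    linear_combination (d' : ℚ[X]) * h + (d : ℚ[X]) * h'
  | monomial m c =>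
    refine ⟨monomial m c.num.toNat, monomial m (-c.num).toNat, c.den, c.den_pos, ?_⟩
    rw [C_mul_monomial, map_monomial, map_monomial, ← monomial_sub]
    congr 1
    have h := congrArg (Int.cast (R := ℚ)) (Int.toNat_sub_toNat_neg c.num)
    rw [Int.cast_sub, Int.cast_natCast, Int.cast_natCast] at h
    simp only [eq_natCast, h]
    exact Rat.den_mul_eq_num c

/-- Scaling the roots by `D` multiplies coefficients by powers of `D`, so they stay in `ℕ`. -/
theorem exists_listPoly_scale (P : ℕ[X]) (D c : ℕ) : ∃ l : List ℕ, ∀ s : ℝ,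
    aeval (D * s) (listPoly l) = c * D ^ P.natDegree * aeval s P := by
  obtain ⟨l, hl⟩ := exists_listPoly_eq (C c * P.scaleRoots D)
  refine ⟨l, fun s => ?_⟩
  have h := scaleRoots_eval₂_mul (p := P) (algebraMap ℕ ℝ) s D
  rw [eq_natCast] at h
  rw [hl, map_mul, aeval_C, eq_natCast, aeval_def, aeval_def, h, mul_assoc]

theorem exists_fracPoly_scale (P Q : ℕ[X]) {d D : ℕ} (hd : 0 < d) (hD : 0 < D) :
    ∃ (a : FracPoly) (κ : ℝ), 0 < κ ∧ (a.2.2 : ℝ) + 1 = κ * d ∧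
      ∀ s : ℝ, aeval (D * s) (listPoly a.1) = κ * aeval s P ∧
        aeval (D * s) (listPoly a.2.1) = κ * aeval s Q := by
  -- Scaling multiplies `P` and `Q` by different powers of `D`; the extra factors make both equal to
  -- `κ = D ^ (deg P + deg Q)`.
  obtain ⟨l, hl⟩ := exists_listPoly_scale P D (D ^ Q.natDegree)
  obtain ⟨l', hl'⟩ := exists_listPoly_scale Q D (D ^ P.natDegree)
  refine ⟨(l, l', D ^ P.natDegree * D ^ Q.natDegree * d - 1),
    D ^ P.natDegree * D ^ Q.natDegree, by positivity, ?_, fun s => ⟨?_, ?_⟩⟩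
  · have : 0 < D ^ P.natDegree * D ^ Q.natDegree * d := by positivity
    have h : D ^ P.natDegree * D ^ Q.natDegree * d - 1 + 1 =
      D ^ P.natDegree * D ^ Q.natDegree * d := by omega
    exact_mod_cast h
  · rw [hl]; push_cast; ring
  · rw [hl']; push_cast; ring

/-- Expanding every coordinate fraction by a positive factor expands the value by a positive factor.
That factor does not depend on the point, so it is the same at both ends of an interval. -/
theorem evalTriple_smul {c : ℕ → ℝ} (hc : ∀ i, 0 < c i) (p : PolyExpr) :
    ∃ K > 0, ∀ u : ℕ → ℝ × ℝ × ℝ,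
      evalTriple (fun i => (c i * (u i).1, c i * (u i).2.1, c i * (u i).2.2)) p =
        (K * (evalTriple u p).1, K * (evalTriple u p).2.1, K * (evalTriple u p).2.2) := by
  induction p with
  | const z => exact ⟨1, one_pos, fun u => by simp [evalTriple]⟩
  | var i => exact ⟨c i, hc i, fun u => rfl⟩
  | add p q hp hq =>
    obtain ⟨K, hK, h⟩ := hp
    obtain ⟨L, hL, h'⟩ := hq
    refine ⟨K * L, mul_pos hK hL, fun u => ?_⟩
    simp only [evalTriple, h, h', tripleAdd, Prod.mk.injEq]
    refine ⟨?_, ?_, ?_⟩ <;> ring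
  | mul p q hp hq =>
    obtain ⟨K, hK, h⟩ := hp
    obtain ⟨L, hL, h'⟩ := hq
    refine ⟨K * L, mul_pos hK hL, fun u => ?_⟩
    simp only [evalTriple, h, h', tripleMul, Prod.mk.injEq]
    refine ⟨?_, ?_, ?_⟩ <;> ring

theorem continuous_evalTriple {u : ℝ → ℕ → ℝ × ℝ × ℝ} (hu : ∀ i, Continuous fun s => u s i)
    (p : PolyExpr) : Continuous fun s => evalTriple (u s) p := by
  induction p with
  | const z => exact continuous_const
  | var i => exact hu i
  | add p q hp hq =>
    simp only [evalTriple, tripleAdd]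
    fun_prop
  | mul p q hp hq =>
    simp only [evalTriple, tripleMul]
    fun_prop

/-- A polynomial that generates the relations of `θ` and changes its sign from `-` to `+`. -/
theorem exists_sign_change {θ : ℝ} (hθ : IsAlgebraic ℚ θ) : ∃ ν : ℚ[X], aeval θ ν = 0 ∧
    (∀ q : ℚ[X], aeval θ q = 0 → ν ∣ q) ∧
    ∀ᶠ s in 𝓝 θ, (s < θ → aeval s ν < 0) ∧ (θ < s → 0 < aeval s ν) := by
  have key (ν : ℚ[X]) (h0 : aeval θ ν = 0) (h1 : 0 < aeval θ (derivative ν)) :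
      ∀ᶠ s in 𝓝 θ, (s < θ → aeval s ν < 0) ∧ (θ < s → 0 < aeval s ν) := by
    have hd : deriv (fun s : ℝ => aeval s ν) θ > 0 := by
      rw [Polynomial.deriv_aeval]; exact h1
    filter_upwards [eventually_nhdsWithin_sign_eq_of_deriv_pos hd h0] with s hs
    constructor
    · intro h
      rwa [sign_neg (sub_neg.2 h), sign_eq_neg_one_iff] at hs
    · intro h
      rwa [sign_pos (sub_pos.2 h), sign_eq_one_iff] at hs
  -- The minimal polynomial is separable, so `θ` is a simple root and the sign changes there; a
  -- negative derivative is corrected by negating the polynomial.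
  have hsep : (minpoly ℚ θ).Separable := (minpoly.irreducible hθ.isIntegral).separable
  have hne := hsep.aeval_derivative_ne_zero (minpoly.aeval ℚ θ)
  rcases lt_or_gt_of_ne hne with h | h
  · refine ⟨-minpoly ℚ θ, by simp, fun q hq => neg_dvd.2 (minpoly.dvd ℚ θ hq), key _ (by simp) ?_⟩
    simpa using h
  · exact ⟨minpoly ℚ θ, minpoly.aeval ℚ θ, fun q hq => minpoly.dvd ℚ θ hq,
      key _ (minpoly.aeval ℚ θ) h⟩

/-- Approximations of `θ` from below and above by fractions with denominator `D + 1`. -/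
theorem tendsto_lower_upper {θ : ℝ} (hθ : 0 < θ) :
    Tendsto (fun D : ℕ => ((⌈((D + 1 : ℕ) : ℝ) * θ⌉₊ - 1 : ℕ) : ℝ) / (D + 1 : ℕ)) atTop (𝓝[<] θ) ∧
    Tendsto (fun D : ℕ => ((⌈((D + 1 : ℕ) : ℝ) * θ⌉₊ - 1 + 2 : ℕ) : ℝ) / (D + 1 : ℕ)) atTop
      (𝓝[>] θ) := by
  -- Write `lo` for the ceiling minus one: `lo < (D + 1) θ ≤ lo + 1`. Length `2` makes the upper
  -- bound strict even if `(D + 1) θ` is an integer.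
  have hb (D : ℕ) : ((⌈((D + 1 : ℕ) : ℝ) * θ⌉₊ - 1 : ℕ) : ℝ) < (D + 1 : ℕ) * θ ∧
      ((D + 1 : ℕ) : ℝ) * θ ≤ ((⌈((D + 1 : ℕ) : ℝ) * θ⌉₊ - 1 : ℕ) : ℝ) + 1 := by
    have h0 : 0 < ((D + 1 : ℕ) : ℝ) * θ := by positivity
    have h1 := Nat.ceil_pos.2 h0
    have h2 := Nat.le_ceil (((D + 1 : ℕ) : ℝ) * θ)
    have h3 := Nat.ceil_lt_add_one h0.le
    rw [Nat.cast_sub h1, Nat.cast_one]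
    constructor <;> linarith
  have hz := tendsto_one_div_add_atTop_nhds_zero_nat (𝕜 := ℝ)
  have hlow : Tendsto (fun D : ℕ => θ - 1 / ((D : ℝ) + 1)) atTop (𝓝 θ) := by
    simpa using tendsto_const_nhds.sub hz
  have hup : Tendsto (fun D : ℕ => θ + 2 * (1 / ((D : ℝ) + 1))) atTop (𝓝 θ) := by
    simpa using tendsto_const_nhds.add (hz.const_mul 2)
  have hD (D : ℕ) : (0 : ℝ) < (D + 1 : ℕ) := by positivity
  constructor
  · refine tendsto_nhdsWithin_iff.2 ⟨?_, .of_forall fun D => ?_⟩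
    · refine tendsto_of_tendsto_of_tendsto_of_le_of_le hlow tendsto_const_nhds
        (fun D => ?_) fun D => ?_
      · have := (hb D).2
        have h := hD D
        simp only
        rw [le_div_iff₀ h, sub_mul]
        generalize (⌈((D + 1 : ℕ) : ℝ) * θ⌉₊ - 1 : ℕ) = m at *
        push_cast at *
        field_simp
        linarith
      · simp only
        rw [div_le_iff₀ (hD D)]
        linarith [(hb D).1]
    · simp only [Set.mem_Iio]
      rw [div_lt_iff₀ (hD D)]
      linarith [(hb D).1]
  · refine tendsto_nhdsWithin_iff.2 ⟨?_, .of_forall fun D => ?_⟩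
    · refine tendsto_of_tendsto_of_tendsto_of_le_of_le tendsto_const_nhds hup
        (fun D => ?_) fun D => ?_
      · simp only
        rw [le_div_iff₀ (hD D), Nat.cast_add]
        push_cast at *
        linarith [(hb D).2]
      · have := (hb D).1
        have h := hD D
        simp only
        rw [div_le_iff₀ h, add_mul, Nat.cast_add]
        generalize (⌈((D + 1 : ℕ) : ℝ) * θ⌉₊ - 1 : ℕ) = m at *
        push_cast at *
        field_simp
        linarith
    · simp only [Set.mem_Ioi]
      rw [lt_div_iff₀ (hD D), Nat.cast_add]
      push_cast at *
      linarith [(hb D).2]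

end VirtualSubst

/-! ### Certificates for all large denominators -/

namespace VirtualSubst

open PolyExpr QF Filter Topology Polynomial

theorem aeval_map_natCast (s : ℝ) (P : ℕ[X]) :
    aeval s (P.map (Nat.castRingHom ℚ)) = aeval s P := aeval_map_algebraMap ℚ s P

/-- Data for certificates with denominators `D + 1` for the point `x`: the coordinates are
`(P i (θ) - Q i (θ)) / d i`; `M D` and `A D` are scaled versions of `ν` and of the coordinates. -/
structure CertData (n : ℕ) (x : ℕ → ℝ) where
  θ : ℝ
  ν : ℚ[X]
  P : ℕ → ℕ[X]
  Q : ℕ → ℕ[X]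
  d : ℕ → ℕ
  M : ℕ → List ℕ × List ℕ
  m : ℕ → ℕ
  A : ℕ → List FracPoly
  κ : ℕ → ℕ → ℝ
  θ_pos : 0 < θ
  dvd : ∀ q : ℚ[X], aeval θ q = 0 → ν ∣ q
  sign : ∀ᶠ s in 𝓝 θ, (s < θ → aeval s ν < 0) ∧ (θ < s → 0 < aeval s ν)
  d_pos : ∀ i, 0 < d i
  coord : ∀ i < n, x i = (aeval θ (P i) - aeval θ (Q i)) / d i
  m_pos : ∀ D, 0 < m D
  M_eq : ∀ D, C (m D : ℚ) * ν.comp (C ((D + 1 : ℕ) : ℚ)⁻¹ * X) =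
    (listPoly (M D).1).map (Nat.castRingHom ℚ) - (listPoly (M D).2).map (Nat.castRingHom ℚ)
  κ_pos : ∀ D i, 0 < κ D i
  A_eq : ∀ D i (s : ℝ), (aeval ((D + 1 : ℕ) * s) (coordPoly (A D) i).1,
      aeval ((D + 1 : ℕ) * s) (coordPoly (A D) i).2.1,
      aeval ((D + 1 : ℕ) * s) (coordPoly (A D) i).2.2) =
    (κ D i * aeval s (P i), κ D i * aeval s (Q i), κ D i * d i)

theorem nonempty_certData {n : ℕ} {x : ℕ → ℝ} (hx : ∀ i < n, IsAlgebraic ℚ (x i)) :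
    Nonempty (CertData n x) := by
  obtain ⟨θ, q, hθ, halg, hq⟩ := exists_pos_generator hx
  obtain ⟨ν, -, hdvd, hsign⟩ := exists_sign_change halg
  -- Beyond `n` the choice `0 / 1` matches the default entry `([], [], 0)`, whose denominator is `0
  -- + 1`; the factor `κ` is `1` there.
  have h1 : ∀ i, ∃ (P Q : ℕ[X]) (d : ℕ), 0 < d ∧
      (i < n → x i = (aeval θ P - aeval θ Q) / d) ∧ (¬ i < n → P = 0 ∧ Q = 0 ∧ d = 1) := by
    intro i
    by_cases hi : i < n
    · obtain ⟨P, Q, d, hd, h⟩ := exists_sub_natPoly (q i)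
      refine ⟨P, Q, d, hd, fun _ => ?_, fun h => (h hi).elim⟩
      have h := congrArg (aeval θ) h
      rw [map_mul, aeval_C, hq i hi, map_sub, aeval_map_natCast,
        aeval_map_natCast] at h
      rw [← h, eq_div_iff (by positivity)]
      simp [mul_comm]
    · exact ⟨0, 0, 1, one_pos, fun h => (hi h).elim, fun _ => ⟨rfl, rfl, rfl⟩⟩
  choose P Q d hd hcoord hzero using h1
  have h2 : ∀ D : ℕ, ∃ (M : List ℕ × List ℕ) (m : ℕ), 0 < m ∧
      C (m : ℚ) * ν.comp (C ((D + 1 : ℕ) : ℚ)⁻¹ * X) =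
        (listPoly M.1).map (Nat.castRingHom ℚ) - (listPoly M.2).map (Nat.castRingHom ℚ) := by
    intro D
    obtain ⟨P, Q, m, hm, h⟩ := exists_sub_natPoly (ν.comp (C ((D + 1 : ℕ) : ℚ)⁻¹ * X))
    obtain ⟨l, rfl⟩ := exists_listPoly_eq P
    obtain ⟨l', rfl⟩ := exists_listPoly_eq Q
    exact ⟨(l, l'), m, hm, h⟩
  choose M m hm hM using h2
  have h3 := fun D i => exists_fracPoly_scale (P i) (Q i) (hd i) (Nat.succ_pos D)
  choose a κ hκ ha1 ha2 using h3
  refine ⟨⟨θ, ν, P, Q, d, M, m, fun D => (List.range n).map (a D),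
    fun D i => if i < n then κ D i else 1, hθ, hdvd, hsign, hd, hcoord, hm, hM, fun D i => ?_,
    fun D i s => ?_⟩⟩
  · split_ifs
    · exact hκ D i
    · exact one_pos
  · by_cases hi : i < n
    · have e : ((List.range n).map (a D)).getD i ([], [], 0) = a D i := by
        simp [List.getD, hi]
      simp only [coordPoly, e, if_pos hi, Prod.mk.injEq]
      refine ⟨(ha2 D i s).1, (ha2 D i s).2, ?_⟩
      rw [← ha1 D i, aeval_C]
      simp
    · obtain ⟨h1, h2, h3⟩ := hzero i hi
      simp [coordPoly, hi, h1, h2, h3, listPoly]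

namespace CertData

variable {n : ℕ} {x : ℕ → ℝ} (T : CertData n x)

/-- Integer part of `(D + 1) θ` (exclusively). -/
noncomputable def lo (D : ℕ) : ℕ := ⌈((D + 1 : ℕ) : ℝ) * T.θ⌉₊ - 1

noncomputable def cert (D : ℕ) (Ks : List FracPoly) : Cert := (T.M D, T.lo D, T.A D, Ks)

/-- The coordinate polynomials at `s`. -/
noncomputable def coordAt (s : ℝ) (i : ℕ) : ℝ × ℝ × ℝ :=
  (aeval s (T.P i), aeval s (T.Q i), (T.d i : ℝ))

theorem tendsto_lo : Tendsto (fun D : ℕ => (T.lo D : ℝ) / (D + 1 : ℕ)) atTop (𝓝[<] T.θ) :=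
  (tendsto_lower_upper T.θ_pos).1

theorem tendsto_hi : Tendsto (fun D : ℕ => ((T.lo D + 2 : ℕ) : ℝ) / (D + 1 : ℕ)) atTop
    (𝓝[>] T.θ) := (tendsto_lower_upper T.θ_pos).2

theorem eventually_rootCert : ∀ᶠ D in atTop, ∀ Ks, RootCert (T.cert D Ks) := by
  have h1 := T.tendsto_lo.eventually ((T.sign.filter_mono nhdsWithin_le_nhds).and
    self_mem_nhdsWithin)
  have h2 := T.tendsto_hi.eventually ((T.sign.filter_mono nhdsWithin_le_nhds).and
    self_mem_nhdsWithin)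
  filter_upwards [h1, h2] with D h1 h2 Ks
  have h1 := h1.1.1 h1.2
  have h2 := h2.1.2 h2.2
  have hm : (0 : ℝ) < T.m D := Nat.cast_pos.2 (T.m_pos D)
  -- Up to the positive factor `m D`, the scaled polynomial at `t` is `ν` at `t / (D + 1)`.
  have key (t : ℕ) : (T.m D : ℝ) * aeval ((t : ℝ) / (D + 1 : ℕ)) T.ν =
      horner (T.M D).1 t - horner (T.M D).2 t := by
    have h := congrArg (aeval (t : ℝ)) (T.M_eq D)
    rw [map_mul, aeval_C, map_sub, aeval_map_natCast,
      aeval_map_natCast, aeval_natCast, aeval_natCast, eval_listPoly,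
      eval_listPoly, aeval_comp, map_mul, aeval_C, aeval_X] at h
    rw [← h, div_eq_inv_mul]
    simp
  constructor
  · have h := mul_neg_of_pos_of_neg hm h1
    rw [key, sub_neg, Nat.cast_lt] at h
    exact h
  · have h := mul_pos hm h2
    rw [key, sub_pos, Nat.cast_lt] at h
    exact h

/-- Independence of `K` from `s` lets comparisons between different arguments survive the scaling.
-/
theorem exists_scale (D : ℕ) (p : PolyExpr) : ∃ K > 0, ∀ s : ℝ,
    aeval ((D + 1 : ℕ) * s) (evalTriple (coordPoly (T.A D)) p).1 =
        K * (evalTriple (T.coordAt s) p).1 ∧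
      aeval ((D + 1 : ℕ) * s) (evalTriple (coordPoly (T.A D)) p).2.1 =
        K * (evalTriple (T.coordAt s) p).2.1 := by
  obtain ⟨K, hK, h⟩ := evalTriple_smul (T.κ_pos D) p
  refine ⟨K, hK, fun s => ?_⟩
  have h1 := evalTriple_aeval (T.A D) ((D + 1 : ℕ) * s) p
  simp only [T.A_eq] at h1
  have h2 := h (T.coordAt s)
  simp only [coordAt] at h2
  rw [h1, Prod.mk.injEq, Prod.mk.injEq] at h2
  exact ⟨h2.1, h2.2.1⟩

theorem exists_scale_nat (D : ℕ) (p : PolyExpr) : ∃ K > 0, ∀ t : ℕ,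
    ((evalCode (T.A D) t p.code).1 : ℝ) = K * (evalTriple (T.coordAt (t / (D + 1 : ℕ))) p).1 ∧
      ((evalCode (T.A D) t p.code).2.1 : ℝ) =
        K * (evalTriple (T.coordAt (t / (D + 1 : ℕ))) p).2.1 := by
  obtain ⟨K, hK, h⟩ := T.exists_scale D p
  refine ⟨K, hK, fun t => ?_⟩
  have h1 := h (t / (D + 1 : ℕ))
  rw [mul_div_cancel₀ _ (by positivity), aeval_natCast, aeval_natCast] at h1
  rwa [evalCode_code, evalTriple_coordTriple]

theorem continuous_evalTriple_coordAt (p : PolyExpr) :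
    Continuous fun s => evalTriple (T.coordAt s) p := by
  refine continuous_evalTriple (fun i => ?_) p
  exact ((T.P i).continuous_aeval).prodMk (((T.Q i).continuous_aeval).prodMk continuous_const)

theorem eval_eq {p : PolyExpr} (hp : p.VarsIn 0 n) : 0 < (evalTriple (T.coordAt T.θ) p).2.2 ∧
    p.eval x = ((evalTriple (T.coordAt T.θ) p).1 - (evalTriple (T.coordAt T.θ) p).2.1) /
      (evalTriple (T.coordAt T.θ) p).2.2 := by
  have h := eval_eq_evalTriple (u := T.coordAt T.θ)
    (v := fun i => (aeval T.θ (T.P i) - aeval T.θ (T.Q i)) / T.d i)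
    (fun i => ⟨Nat.cast_pos.2 (T.d_pos i), rfl⟩) p
  refine ⟨h.1, h.2 ▸ PolyExpr.eval_congr (fun i _ hi => T.coord i hi) hp⟩

/-- Both ends of the interval, divided by `D + 1`, tend to `θ`. By continuity the strict inequality
between the parts of the numerator at `θ` persists when they are taken at different ends. -/
theorem eventually_posCert {p : PolyExpr} (hp : p.VarsIn 0 n) (h : 0 < p.eval x) :
    ∀ᶠ D in atTop, ∀ Ks, PosCert (T.cert D Ks) p.code := by
  obtain ⟨h1, h2⟩ := T.eval_eq hp
  rw [h2, div_pos_iff_of_pos_right h1, sub_pos] at h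
  have hc := (T.continuous_evalTriple_coordAt p).tendsto T.θ
  have hlo := (hc.comp (tendsto_nhdsWithin_iff.1 T.tendsto_lo).1).fst_nhds
  have hhi := (hc.comp (tendsto_nhdsWithin_iff.1 T.tendsto_hi).1).snd_nhds.fst_nhds
  filter_upwards [hhi.eventually_lt hlo h] with D hD Ks
  obtain ⟨K, hK, hs⟩ := T.exists_scale_nat D p
  have := mul_lt_mul_of_pos_left hD hK
  simp only [Function.comp_apply] at this
  rw [← (hs _).1, ← (hs _).2, Nat.cast_lt] at this
  exact this

theorem eventually_negCert {p : PolyExpr} (hp : p.VarsIn 0 n) (h : p.eval x < 0) :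
    ∀ᶠ D in atTop, ∀ Ks, NegCert (T.cert D Ks) p.code := by
  obtain ⟨h1, h2⟩ := T.eval_eq hp
  rw [h2, div_lt_iff₀ h1, zero_mul, sub_neg] at h
  have hc := (T.continuous_evalTriple_coordAt p).tendsto T.θ
  have hlo := (hc.comp (tendsto_nhdsWithin_iff.1 T.tendsto_lo).1).snd_nhds.fst_nhds
  have hhi := (hc.comp (tendsto_nhdsWithin_iff.1 T.tendsto_hi).1).fst_nhds
  filter_upwards [hhi.eventually_lt hlo h] with D hD Ks
  obtain ⟨K, hK, hs⟩ := T.exists_scale_nat D p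
  have := mul_lt_mul_of_pos_left hD hK
  simp only [Function.comp_apply] at this
  rw [← (hs _).1, ← (hs _).2, Nat.cast_lt] at this
  exact this

/-- The numerator, scaled back, vanishes at `θ` and is therefore divisible by `ν`. Scaling the
quotient and clearing denominators gives the identity over `ℕ`, for every `D`. -/
theorem exists_zeroCert {p : PolyExpr} (hp : p.VarsIn 0 n) (h : p.eval x = 0) (D : ℕ) :
    ∃ K : FracPoly, ∀ Ks, K ∈ Ks → ZeroCert (T.cert D Ks) p.code := by
  obtain ⟨h1, h2⟩ := T.eval_eq hp
  rw [h2, div_eq_zero_iff, or_iff_left h1.ne', sub_eq_zero] at h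
  have hD : ((D + 1 : ℕ) : ℚ) ≠ 0 := by positivity
  set G := evalTriple (coordPoly (T.A D)) p with hG
  set R : ℚ[X] := G.1.map (Nat.castRingHom ℚ) - G.2.1.map (Nat.castRingHom ℚ) with hR
  have hR0 : aeval T.θ (R.comp (C ((D + 1 : ℕ) : ℚ) * X)) = 0 := by
    obtain ⟨K, -, hs⟩ := T.exists_scale D p
    rw [aeval_comp, map_mul, aeval_C, aeval_X, hR, map_sub, aeval_map_natCast,
      aeval_map_natCast, map_natCast, (hs T.θ).1, (hs T.θ).2, h, sub_self]
  obtain ⟨q, hq⟩ := T.dvd _ hR0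
  have hR1 : R = T.ν.comp (C ((D + 1 : ℕ) : ℚ)⁻¹ * X) *
      q.comp (C ((D + 1 : ℕ) : ℚ)⁻¹ * X) := by
    rw [← mul_comp, ← hq, comp_assoc, mul_comp, C_comp, X_comp, ← mul_assoc, ← C_mul,
      mul_inv_cancel₀ hD, C_1, one_mul, comp_X]
  obtain ⟨K1, K2, c, hc, hK⟩ := exists_sub_natPoly (q.comp (C ((D + 1 : ℕ) : ℚ)⁻¹ * X))
  obtain ⟨l1, rfl⟩ := exists_listPoly_eq K1
  obtain ⟨l2, rfl⟩ := exists_listPoly_eq K2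
  -- The denominator is `m D * c`, from `M` and from the quotient; its predecessor is stored.
  refine ⟨(l1, l2, T.m D * c - 1), fun Ks hKs => ⟨_, hKs, ?_⟩⟩
  rw [isQuot_code_iff]
  apply map_injective (Nat.castRingHom ℚ) Nat.cast_injective
  have hmc : T.m D * c - 1 + 1 = T.m D * c := Nat.sub_add_cancel (mul_pos (T.m_pos D) hc)
  have hM := T.M_eq D
  simp only [quotPolys, cert, hmc, Polynomial.map_add, Polynomial.map_mul, ← hG,
    eq_natCast, Nat.cast_mul]
  have e : C (T.m D : ℚ) * C (c : ℚ) * R =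
      ((listPoly (T.M D).1).map (Nat.castRingHom ℚ) -
        (listPoly (T.M D).2).map (Nat.castRingHom ℚ)) *
      ((listPoly l1).map (Nat.castRingHom ℚ) - (listPoly l2).map (Nat.castRingHom ℚ)) := by
    rw [← hM, ← hK, hR1]; ring
  rw [hR] at e
  simp only [map_natCast, Polynomial.map_natCast] at e ⊢
  linear_combination e

/-- Quantifying over all lists that contain `Ks₀` allows the quotient lists of two conjuncts to be
concatenated. -/
theorem eventually_satCode {φ : QF} (hφ : φ.VarsIn 0 n) (h : φ.Sat x) :
    ∀ᶠ D in atTop, ∃ Ks₀ : List FracPoly, ∀ Ks, Ks₀ ⊆ Ks →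
      satCode (T.cert D Ks) φ.code = true := by
  induction φ with
  | tt => exact .of_forall fun D => ⟨[], fun Ks _ => satCode_tt _⟩
  | ff => exact h.elim
  | atom p ρ =>
    simp only [satCode_atom]
    rcases lt_trichotomy (p.eval x) 0 with hlt | heq | hgt
    · filter_upwards [T.eventually_negCert hφ hlt] with D hD
      refine ⟨[], fun Ks _ => .inr (.inr ⟨?_, hD Ks⟩)⟩
      cases ρ <;> simp only [Sat, Rel.Holds] at h <;> simp [Rel.code] <;> linarith
    · refine .of_forall fun D => ?_
      obtain ⟨K, hK⟩ := T.exists_zeroCert hφ heq D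
      refine ⟨[K], fun Ks hKs => .inl ⟨?_, hK Ks (hKs (by simp))⟩⟩
      cases ρ <;> simp [Sat, Rel.Holds, heq] at h <;> simp [Rel.code]
    · filter_upwards [T.eventually_posCert hφ hgt] with D hD
      refine ⟨[], fun Ks _ => .inr (.inl ⟨?_, hD Ks⟩)⟩
      cases ρ <;> simp only [Sat, Rel.Holds] at h <;> simp [Rel.code] <;> linarith
  | and φ χ h1 h2 =>
    filter_upwards [h1 hφ.1 h.1, h2 hφ.2 h.2] with D ⟨K1, hK1⟩ ⟨K2, hK2⟩
    refine ⟨K1 ++ K2, fun Ks hKs => ?_⟩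
    rw [List.append_subset] at hKs
    exact (satCode_and _ _ _).2 ⟨hK1 Ks hKs.1, hK2 Ks hKs.2⟩
  | or φ χ h1 h2 =>
    rcases h with h | h
    · filter_upwards [h1 hφ.1 h] with D ⟨K, hK⟩
      exact ⟨K, fun Ks hKs => (satCode_or _ _ _).2 (.inl (hK Ks hKs))⟩
    · filter_upwards [h2 hφ.2 h] with D ⟨K, hK⟩
      exact ⟨K, fun Ks hKs => (satCode_or _ _ _).2 (.inr (hK Ks hKs))⟩

end CertData

theorem exists_cert {n : ℕ} {x : ℕ → ℝ} (hx : ∀ i < n, IsAlgebraic ℚ (x i)) {φ : QF}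
    (hφ : φ.VarsIn 0 n) (h : φ.Sat x) : ∃ C, RootCert C ∧ satCode C φ.code = true := by
  obtain ⟨T⟩ := nonempty_certData hx
  obtain ⟨D, h1, Ks, h2⟩ := (T.eventually_rootCert.and (T.eventually_satCode hφ h)).exists
  exact ⟨_, h1 Ks, h2 Ks (List.Subset.refl _)⟩

theorem exists_sat_of_cert {C : Cert} (hC : RootCert C) {φ : QF} (h : satCode C φ.code = true) :
    ∃ x, φ.Sat x := by
  obtain ⟨θ, hlo, hhi, hθ⟩ := exists_root_of_rootCert hC
  exact ⟨_, sat_of_satCode hθ hlo hhi h⟩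

end VirtualSubst

/-! ### The search on Gödel numbers -/

namespace VirtualSubst

open PolyExpr QF

/-! ### Pinned schemes on codes -/

def addCode (p q : ℕ) : ℕ := Nat.pair 2 (Nat.pair p q)

def mulCode (p q : ℕ) : ℕ := Nat.pair 3 (Nat.pair p q)

def subCode (p q : ℕ) : ℕ := addCode p (mulCode (const (-1)).code q)

def atomCode (p r : ℕ) : ℕ := Nat.pair 2 (Nat.pair p r)

def andCode (φ χ : ℕ) : ℕ := Nat.pair 3 (Nat.pair φ χ)

/-- The code of `(a + b √c) / d`. -/
def rootCode (a b c d : ℕ) : ℕ := Nat.pair 0 (Nat.pair (Nat.pair a b) (Nat.pair c d))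

/-- The code of the standardization, `t` being the code of the integer. -/
def standardizeCode (t e : ℕ) : ℕ :=
  if e.unpair.1 = 1 then
    rootCode
      (addCode (mulCode (Nat.pair 0 t) e.unpair.2.unpair.2.unpair.1.unpair.1)
        e.unpair.2.unpair.2.unpair.2.unpair.2)
      (mulCode (Nat.pair 0 t) e.unpair.2.unpair.2.unpair.1.unpair.2)
      e.unpair.2.unpair.2.unpair.2.unpair.1
      (mulCode (Nat.pair 0 t) e.unpair.2.unpair.2.unpair.2.unpair.2)
  else if e.unpair.1 = 2 then
    rootCode (Nat.pair 0 t) (const 0).code (const 0).code (const 1).code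
  else e

/-- Only codes of standard terms matter, so every nonzero tag is treated as a `g`-th root; likewise
in `equalsCode`. -/
def meaningfulCode (k e : ℕ) : ℕ :=
  if e.unpair.1 = 0 then
    andCode (atomCode e.unpair.2.unpair.2.unpair.1 4) (atomCode e.unpair.2.unpair.2.unpair.2 1)
  else if e.unpair.2 % 2 = 0 then atomCode (Nat.pair 1 (k + 1)) 4 else tt.code

/-- The code of `d x_k - a`. -/
def linearCode (k e : ℕ) : ℕ :=
  subCode (mulCode e.unpair.2.unpair.2.unpair.2 (Nat.pair 1 k)) e.unpair.2.unpair.1.unpair.1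

def equalsCode (k e : ℕ) : ℕ :=
  if e.unpair.1 = 0 then
    andCode
      (atomCode (subCode (mulCode (linearCode k e) (linearCode k e))
        (mulCode (mulCode e.unpair.2.unpair.1.unpair.2 e.unpair.2.unpair.1.unpair.2)
          e.unpair.2.unpair.2.unpair.1)) 0)
      (atomCode (mulCode e.unpair.2.unpair.1.unpair.2 (linearCode k e)) 4)
  else
    andCode
      (atomCode (subCode ((mulCode (Nat.pair 1 k))^[e.unpair.2] (const 1).code)
        (Nat.pair 1 (k + 1))) 0)
      (if e.unpair.2 % 2 = 0 then atomCode (Nat.pair 1 k) 4 else tt.code)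

theorem standardizeCode_code (z : ℤ) (e : ElimTerm) :
    standardizeCode (Encodable.encode z) e.code = (e.standardize z).code := by
  cases e <;> simp [standardizeCode, ElimTerm.code, ElimTerm.standardize, RootExpr.code, rootCode,
    addCode, mulCode, PolyExpr.code]

theorem meaningfulCode_code (k : ℕ) {e : ElimTerm} (he : e.Standard) :
    meaningfulCode k e.code = (meaningfulFormula k e).code := by
  cases e with
  | root e =>
    simp [meaningfulCode, ElimTerm.code, meaningfulFormula, RootExpr.code, andCode, atomCode,
      QF.code, Rel.code]
  | rootEps e plus => exact he.elim
  | inf plus => exact he.elim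
  | gthRoot g =>
    by_cases h : g % 2 = 0 <;> simp [meaningfulCode, ElimTerm.code, meaningfulFormula, atomCode,
      QF.code, Rel.code, PolyExpr.code, h]

theorem code_iterate_mul (k g : ℕ) : ((PolyExpr.mul (var k))^[g] (const 1)).code =
    (mulCode (Nat.pair 1 k))^[g] (const 1).code := by
  induction g with
  | zero => rfl
  | succ g ih =>
    rw [Function.iterate_succ_apply', Function.iterate_succ_apply', ← ih]
    rfl

theorem equalsCode_code (k : ℕ) {e : ElimTerm} (he : e.Standard) :
    equalsCode k e.code = (equalsFormula k e).code := by
  cases e with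
  | root e =>
    simp [equalsCode, linearCode, ElimTerm.code, equalsFormula, RootExpr.code, andCode, atomCode,
      subCode, addCode, mulCode, PolyExpr.sub, PolyExpr.neg, PolyExpr.code, QF.code, Rel.code]
  | rootEps e plus => exact he.elim
  | inf plus => exact he.elim
  | gthRoot g =>
    by_cases h : g % 2 = 0 <;> simp [equalsCode, ElimTerm.code, equalsFormula, andCode, atomCode,
      subCode, addCode, PolyExpr.sub, PolyExpr.neg, QF.code, Rel.code, PolyExpr.code,
      code_iterate_mul, h] <;> rfl

/-- One row of the pinned scheme: `s` holds the rows found so far and the formula that determines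
the later variables. -/
def pinnedStep (n : ℕ) (ts : List ℕ) (a : ℕ) (s : List ℕ × ℕ) : List ℕ × ℕ :=
  let k := n - 1 - s.1.length
  let e := standardizeCode (ts.getD k 0) a.unpair.1
  (Nat.pair e (andCode (meaningfulCode k e) s.2) :: s.1,
    andCode (equalsCode k e) (andCode (meaningfulCode k e) s.2))

def pinnedCode (ts rows : List ℕ) : List ℕ × ℕ :=
  rows.foldr (pinnedStep rows.length ts) ([], tt.code)

theorem foldr_pinnedStep {n k : ℕ} {zs : ℕ → ℤ} {ts : List ℕ}
    (hts : ∀ i < n, ts.getD i 0 = Encodable.encode (zs i)) {S : Scheme} (hn : k + S.length = n) :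
    (S.map fun row => Nat.pair row.1.code row.2.code).foldr (pinnedStep n ts) ([], tt.code) =
      ((pinnedScheme zs k S).1.map fun row => Nat.pair row.1.code row.2.code,
        (pinnedScheme zs k S).2.code) := by
  induction S generalizing k with
  | nil => rfl
  | cons row S ih =>
    obtain ⟨e, γ⟩ := row
    rw [List.length_cons] at hn
    rw [List.map_cons, List.foldr_cons, ih (by omega : k + 1 + S.length = n)]
    -- The fold starts from the last row, so the index of a row is read off from the number of rows
    -- already treated.
    have hk : n - 1 - S.length = k := by omega
    have hstd := e.standard_standardize (zs k)
    simp only [pinnedStep, List.length_map, length_pinnedScheme, hk, hts k (by omega),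
      Nat.unpair_pair, standardizeCode_code, meaningfulCode_code k hstd, equalsCode_code k hstd,
      pinnedScheme, List.map_cons]
    rfl

theorem pinnedCode_map_code {zs : ℕ → ℤ} {ts : List ℕ} {S : Scheme}
    (hts : ∀ i < S.length, ts.getD i 0 = Encodable.encode (zs i)) :
    pinnedCode ts (S.map fun row => Nat.pair row.1.code row.2.code) =
      ((pinnedScheme zs 0 S).1.map fun row => Nat.pair row.1.code row.2.code,
        (pinnedScheme zs 0 S).2.code) := by
  rw [pinnedCode, List.length_map]
  exact foldr_pinnedStep hts (zero_add _)

/-! ### Primitive recursiveness of the pinned scheme -/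

section Primrec

open Primrec

variable {α : Type} [Primcodable α] {f g h j : α → ℕ}

theorem primrec_natPair (hf : Primrec f) (hg : Primrec g) :
    Primrec fun a => Nat.pair (f a) (g a) := Primrec₂.natPair.comp hf hg

theorem primrec_left (hf : Primrec f) : Primrec fun a => (f a).unpair.1 := fst.comp (unpair.comp hf)

theorem primrec_right (hf : Primrec f) : Primrec fun a => (f a).unpair.2 :=
  snd.comp (unpair.comp hf)

theorem primrec_addCode (hf : Primrec f) (hg : Primrec g) :
    Primrec fun a => addCode (f a) (g a) := primrec_natPair (.const 2) (primrec_natPair hf hg)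

theorem primrec_mulCode (hf : Primrec f) (hg : Primrec g) :
    Primrec fun a => mulCode (f a) (g a) := primrec_natPair (.const 3) (primrec_natPair hf hg)

theorem primrec_subCode (hf : Primrec f) (hg : Primrec g) :
    Primrec fun a => subCode (f a) (g a) := primrec_addCode hf (primrec_mulCode (.const _) hg)

theorem primrec_atomCode (hf : Primrec f) (r : ℕ) : Primrec fun a => atomCode (f a) r :=
  primrec_natPair (.const 2) (primrec_natPair hf (.const r))

theorem primrec_andCode (hf : Primrec f) (hg : Primrec g) :
    Primrec fun a => andCode (f a) (g a) := primrec_natPair (.const 3) (primrec_natPair hf hg)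

theorem primrec_rootCode (hf : Primrec f) (hg : Primrec g) (hh : Primrec h) (hj : Primrec j) :
    Primrec fun a => rootCode (f a) (g a) (h a) (j a) :=
  primrec_natPair (.const 0) (primrec_natPair (primrec_natPair hf hg) (primrec_natPair hh hj))

theorem primrecPred_left_eq (hf : Primrec f) (m : ℕ) : PrimrecPred fun a => (f a).unpair.1 = m :=
  Primrec.eq.comp (primrec_left hf) (.const m)

theorem primrecPred_even_right (hf : Primrec f) : PrimrecPred fun a => (f a).unpair.2 % 2 = 0 :=
  Primrec.eq.comp (nat_mod.comp (primrec_right hf) (.const 2)) (.const 0)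

theorem primrec_standardizeCode (hf : Primrec f) (hg : Primrec g) :
    Primrec fun a => standardizeCode (f a) (g a) := by
  have ht := primrec_natPair (.const 0) hf
  have hr := primrec_right (primrec_right hg)
  refine Primrec.ite (primrecPred_left_eq hg 1) ?_
    (Primrec.ite (primrecPred_left_eq hg 2) ?_ hg)
  · exact primrec_rootCode
      (primrec_addCode (primrec_mulCode ht (primrec_left (primrec_left hr)))
        (primrec_right (primrec_right hr)))
      (primrec_mulCode ht (primrec_right (primrec_left hr)))
      (primrec_left (primrec_right hr))
      (primrec_mulCode ht (primrec_right (primrec_right hr)))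
  · exact primrec_rootCode ht (.const _) (.const _) (.const _)

theorem primrec_meaningfulCode (hf : Primrec f) (hg : Primrec g) :
    Primrec fun a => meaningfulCode (f a) (g a) := by
  have hr := primrec_right (primrec_right hg)
  refine Primrec.ite (primrecPred_left_eq hg 0) ?_
    (Primrec.ite (primrecPred_even_right hg) ?_ (.const _))
  · exact primrec_andCode (primrec_atomCode (primrec_left hr) _)
      (primrec_atomCode (primrec_right hr) _)
  · exact primrec_atomCode (primrec_natPair (.const 1) (succ.comp hf)) _

theorem primrec_linearCode (hf : Primrec f) (hg : Primrec g) :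
    Primrec fun a => linearCode (f a) (g a) :=
  primrec_subCode
    (primrec_mulCode (primrec_right (primrec_right (primrec_right hg)))
      (primrec_natPair (.const 1) hf))
    (primrec_left (primrec_left (primrec_right hg)))

theorem primrec_equalsCode (hf : Primrec f) (hg : Primrec g) :
    Primrec fun a => equalsCode (f a) (g a) := by
  have hl := primrec_linearCode hf hg
  have hb := primrec_right (primrec_left (primrec_right hg))
  have hc := primrec_left (primrec_right (primrec_right hg))
  have hv := primrec_natPair (.const 1) hf
  refine Primrec.ite (primrecPred_left_eq hg 0) ?_ ?_
  · exact primrec_andCode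
      (primrec_atomCode (primrec_subCode (primrec_mulCode hl hl)
        (primrec_mulCode (primrec_mulCode hb hb) hc)) _)
      (primrec_atomCode (primrec_mulCode hb hl) _)
  · refine primrec_andCode (primrec_atomCode (primrec_subCode ?_
      (primrec_natPair (.const 1) (succ.comp hf))) _)
      (Primrec.ite (primrecPred_even_right hg) (primrec_atomCode hv _) (.const _))
    exact nat_iterate (primrec_right hg) (.const _)
      (primrec_mulCode (hv.comp fst) snd).to₂

theorem primrec_pinnedCode : Primrec₂ pinnedCode := by
  refine list_foldr (α := List ℕ × List ℕ) (f := fun x => x.2) (g := fun _ => ([], tt.code))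
    (h := fun x y => pinnedStep x.2.length x.1 y.1 y.2) snd (.const _) ?_
  have hs : Primrec fun z : (List ℕ × List ℕ) × ℕ × List ℕ × ℕ => z.2.2.1 :=
    fst.comp (snd.comp snd)
  have hk : Primrec fun z : (List ℕ × List ℕ) × ℕ × List ℕ × ℕ =>
      z.1.2.length - 1 - z.2.2.1.length :=
    nat_sub.comp (nat_sub.comp (list_length.comp (snd.comp fst)) (.const 1)) (list_length.comp hs)
  have he := primrec_standardizeCode ((list_getD 0).comp (fst.comp fst) hk)
    (primrec_left (fst.comp (snd : Primrec fun z : (List ℕ × List ℕ) × ℕ × List ℕ × ℕ => z.2)))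
  have hγ := primrec_andCode (primrec_meaningfulCode hk he) (snd.comp (snd.comp snd))
  exact pair (list_cons.comp (primrec_natPair he hγ) hs)
    (primrec_andCode (primrec_equalsCode hk he) hγ)

end Primrec

/-! ### The algorithm -/

/-- The rows of the scheme in the input `Nat.pair ψ S`. -/
def inputRows (x : ℕ) : List ℕ := (Encodable.decode x.unpair.2).getD []

/-- The pinned scheme for the integers with the codes `w.1` is certified by `w.2`. -/
def Certified (x : ℕ) (w : List ℕ × Cert) : Prop :=
  RootCert w.2 ∧ satCode w.2 (andCode x.unpair.1 (pinnedCode w.1 (inputRows x)).2) = true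

open Classical in
/-- The output if `w` is certified. -/
noncomputable def tryCert (x w : ℕ) : Option ℕ :=
  (Encodable.decode (α := List ℕ × Cert) w).bind fun w =>
    if Certified x w then some (Encodable.encode (pinnedCode w.1 (inputRows x)).1) else none

open Primrec in
theorem primrec_tryCert : Primrec₂ tryCert := by
  classical
  have hrows : Primrec fun y : (ℕ × ℕ) × List ℕ × Cert => inputRows y.1.1 :=
    option_getD.comp (Primrec.decode.comp (primrec_right (fst.comp fst))) (.const [])
  have hpin : Primrec fun y : (ℕ × ℕ) × List ℕ × Cert => pinnedCode y.2.1 (inputRows y.1.1) :=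
    primrec_pinnedCode.comp (fst.comp snd) hrows
  refine option_bind (Primrec.decode.comp snd) ?_
  refine Primrec.ite ?_ (option_some.comp (Primrec.encode.comp (fst.comp hpin))) (.const none)
  refine (primrecPred_rootCert.comp (snd.comp snd)).and (Primrec.eq.comp ?_ (.const true))
  exact primrec_satCode.comp (snd.comp snd)
    (primrec_andCode (primrec_left (fst.comp fst)) (snd.comp hpin))

theorem inputRows_code (ψ : QF) (S : Scheme) : inputRows (Nat.pair ψ.code S.code) =
    S.map fun row => Nat.pair row.1.code row.2.code := by
  rw [inputRows, Nat.unpair_pair, Scheme.code, Encodable.encodek]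
  rfl

theorem mem_tryCert_iff (x w r : ℕ) : r ∈ tryCert x w ↔
    ∃ u, Encodable.decode (α := List ℕ × Cert) w = some u ∧ Certified x u ∧
      r = Encodable.encode (pinnedCode u.1 (inputRows x)).1 := by
  simp only [tryCert, Option.mem_def, Option.bind_eq_some_iff]
  refine exists_congr fun u => and_congr_right fun _ => ?_
  by_cases h : Certified x u <;> simp [h, eq_comm]

theorem IsPreEQR.rowsAll {n : ℕ} {ψ : QF} {S : Scheme} (h : IsPreEQR n ψ S) :
    RowsAll (fun k e γ => (e.WellFormed n k ∧ γ.VarsIn (k + 1) n) ∧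
      ∀ v : ℕ → ℝ, γ.Sat v → e.Meaningful k v) 0 S :=
  (rowsAll_iff _ _ _).2 fun j e γ hj => by
    rw [zero_add]
    exact ⟨h.wellFormed j e γ hj, h.guards j e γ hj⟩

theorem IsPreEQR.rowsAll_wellFormed {n : ℕ} {ψ : QF} {S : Scheme} (h : IsPreEQR n ψ S) :
    RowsAll (fun k e _ => e.WellFormed n k) 0 S :=
  (rowsAll_iff _ _ _).2 fun j e γ hj => by
    rw [zero_add]
    exact (h.wellFormed j e γ hj).1

theorem IsPreEQR.pinnedScheme {n : ℕ} {ψ : QF} {S : Scheme} (h : IsPreEQR n ψ S) {zs : ℕ → ℤ}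
    {x : ℕ → ℝ} (hψ : ψ.Sat x) (hpin : (pinnedScheme zs 0 S).2.Sat x) :
    IsPreEQR n ψ (pinnedScheme zs 0 S).1 := by
  have hn : 0 + S.length = n := (zero_add _).trans h.length_eq
  have hrows := (rowsAll_iff _ _ _).1 (rowsAll_pinnedScheme (zs := zs) h.rowsAll_wellFormed hn)
  simp only [zero_add] at hrows
  exact
    { closed := h.closed
      length_eq := length_pinnedScheme.trans h.length_eq
      wellFormed := fun k e γ hk => (hrows k e γ hk).1
      guards := fun k e γ hk => (hrows k e γ hk).2
      holds := h.holds
      result := substTrue_pinnedScheme h.rowsAll_wellFormed hn h.closed hψ hpin }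

/-- Termination of the search: the point from the given pre-EQR supplies the integers and, being
algebraic, has a certificate. -/
theorem exists_tryCert {n : ℕ} {ψ : QF} {S : Scheme} (h : IsPreEQR n ψ S) :
    ∃ w r, r ∈ tryCert (Nat.pair ψ.code S.code) w := by
  have hn : 0 + S.length = n := (zero_add _).trans h.length_eq
  obtain ⟨zs, x, hψ, hpin⟩ := exists_pinned_point h.rowsAll h.rowsAll_wellFormed hn h.result
  have halg := isAlgebraic_of_sat_pinnedScheme h.rowsAll_wellFormed hn hpin
  obtain ⟨C, hC, hsat⟩ := exists_cert (fun i hi => halg i (Nat.zero_le i) hi)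
    (φ := and ψ (VirtualSubst.pinnedScheme zs 0 S).2)
    ⟨h.closed, varsIn_pinnedScheme h.rowsAll_wellFormed hn⟩ ⟨hψ, hpin⟩
  set ts := (List.range n).map fun i => Encodable.encode (zs i) with hts
  refine ⟨Encodable.encode (ts, C), _,
    (mem_tryCert_iff _ _ _).2 ⟨(ts, C), Encodable.encodek _, ⟨hC, ?_⟩, rfl⟩⟩
  rw [inputRows_code, pinnedCode_map_code (zs := zs), Nat.unpair_pair]
  · exact hsat
  · intro i hi
    rw [h.length_eq] at hi
    simp [hts, List.getD, hi]

/-- Correctness of any hit, whatever integers it uses: the certificate yields a point that satisfies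
`ψ` and the pinning formula, which is all the new scheme needs. -/
theorem isPreEQR_of_mem_tryCert {n : ℕ} {ψ : QF} {S : Scheme} (h : IsPreEQR n ψ S) {w r : ℕ}
    (hr : r ∈ tryCert (Nat.pair ψ.code S.code) w) :
    ∃ S' : Scheme, r = S'.code ∧ (∀ row ∈ S', row.1.Standard) ∧ IsPreEQR n ψ S' := by
  obtain ⟨⟨ts, C⟩, -, ⟨hC, hsat⟩, rfl⟩ := (mem_tryCert_iff _ _ _).1 hr
  -- Every natural number, also the default `0` of a list that is too short, is the code of an
  -- integer.
  have hts : ∀ i < S.length,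
      ts.getD i 0 = Encodable.encode (Equiv.intEquivNat.symm (ts.getD i 0)) := fun i _ =>
    (Equiv.intEquivNat.apply_symm_apply _).symm
  have hp := pinnedCode_map_code (zs := fun i => Equiv.intEquivNat.symm (ts.getD i 0)) hts
  rw [inputRows_code, hp, Nat.unpair_pair] at hsat
  rw [inputRows_code, hp]
  obtain ⟨x, hψ, hpin⟩ := exists_sat_of_cert hC
    (φ := and ψ (VirtualSubst.pinnedScheme _ 0 S).2) hsat
  exact ⟨_, rfl, standard_of_mem_pinnedScheme, h.pinnedScheme hψ hpin⟩

end VirtualSubst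

theorem mainTheorem2 :
    ∃ F : ℕ →. ℕ, Nat.Partrec F ∧
      ∀ (n : ℕ) (ψ : VirtualSubst.QF) (S : VirtualSubst.Scheme),
        VirtualSubst.IsPreEQR n ψ S →
          ∃ S' : VirtualSubst.Scheme,
            VirtualSubst.Scheme.code S' ∈
              F (Nat.pair (VirtualSubst.QF.code ψ) (VirtualSubst.Scheme.code S)) ∧
            (∀ row ∈ S', row.1.Standard) ∧
            VirtualSubst.IsPreEQR n ψ S' := by
  -- Unbounded search through all pairs of integers and certificates; the first hit is the output.
  refine ⟨fun x => Nat.rfindOpt (VirtualSubst.tryCert x),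
    Partrec.nat_iff.1 (Partrec.rfindOpt VirtualSubst.primrec_tryCert.to_comp), ?_⟩
  intro n ψ S h
  obtain ⟨r, hr⟩ := Part.dom_iff_mem.1
    (Nat.rfindOpt_dom.2 (VirtualSubst.exists_tryCert h))
  obtain ⟨w, hw⟩ := Nat.rfindOpt_spec hr
  obtain ⟨S', rfl, h1, h2⟩ := VirtualSubst.isPreEQR_of_mem_tryCert h hw
  exact ⟨S', hr, h1, h2⟩
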